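/- Let $k$ be an algebraically closed field and let $\mathcal A$ be a $k$-linear abelian category which is Ext-finite ($\dim_k \operatorname{Ext}^i(X,Y)<\infty$ for all objects $X,Y$ and all $i\ge 0$) and hereditary ($\operatorname{Ext}^2(X,Y)=0$ for all $X,Y$), and which has Serre duality, i.e. the bounded derived category $D^b\mathcal A$ admits a Serre functor: an auto-equivalence $\mathbb S$ of $D^b\mathcal A$ together with $k$-linear isomorphisms $\operatorname{Hom}(X,Y)\cong\operatorname{Hom}(Y,\mathbb S X)^*$ natural in $X$ and $Y$. Write $\tau=\mathbb S[-1]$ for the Auslander-Reiten translate. The Auslander-Reiten quiver of $D^b\mathcal A$ has as vertices the isomorphism classes of indecomposable objects, and $\dim_k \operatorname{rad}(X,Y)/\operatorname{rad}^2(X,Y)$ arrows from $X$ to $Y$, where $\operatorname{rad}$ is the radical of the category $D^b\mathcal A$; it carries the translation $X\mapsto\tau X$. An Auslander-Reiten component is a connected component of this quiver. Let $\mathbb Z A_\infty$ be the translation quiver with vertices $(i,m)$, $i\in\mathbb Z$, $m\in\mathbb N=\{0,1,2,\dots\}$, with one arrow $(i,m)\to(i,m+1)$ and one arrow $(i,m+1)\to(i+1,m)$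 for all $i,m$ and no others, and with translation $\tau(i,m)=(i-1,m)$. A component is called a tube if it is isomorphic, as a translation quiver, to $\mathbb Z A_\infty/\langle\tau^r\rangle$ for some integer $r\ge 1$. **Theorem.** An Auslander-Reiten component of $D^b\mathcal A$ is a tube if and only if it contains an indecomposable object $X$ such that $\tau^r X\cong X$ for some integer $r\ge 1$. -/

import Mathlib

open CategoryTheory CategoryTheory.Limits

universe t w v u

/-! ### Abelian categories: Ext-finiteness and heredity -/

section Abelian

variable (A : Type u) [Category.{v} A] [Abelian A]

/-- A `k`-linear abelian category is Ext-finite if all `Ext^i(X, Y)`, `i ≥ 0`, are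
finite-dimensional over `k`. -/
def IsExtFinite (k : Type t) [Field k] [Linear k A] : Prop :=
  letI := HasExt.standard A
  ∀ (X Y : A) (i : ℕ), Module.Finite k (Abelian.Ext X Y i)

/-- An abelian category is hereditary if `Ext^2(X, Y) = 0` for all `X`, `Y`. -/
def IsHereditary : Prop :=
  letI := HasExt.standard A
  ∀ (X Y : A), Subsingleton (Abelian.Ext X Y 2)

end Abelian

/-! ### Serre functors -/

/-- A Serre functor on a `k`-linear category `C`: an auto-equivalence `S` together with
`k`-linear isomorphisms `Hom(X, Y) ≅ Hom(Y, S X)^*` natural in `X` and `Y`. -/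
structure SerreFunctor (k : Type t) [Field k] (C : Type u) [Category.{v} C] [Preadditive C]
    [Linear k C] where
  /-- the auto-equivalence -/
  S : C ⥤ C
  isEquivalence : S.IsEquivalence
  /-- the duality isomorphisms -/
  iso (X Y : C) : (X ⟶ Y) ≃ₗ[k] Module.Dual k (Y ⟶ S.obj X)
  naturality_left {X' X Y : C} (f : X' ⟶ X) (g : X ⟶ Y) (h : Y ⟶ S.obj X') :
    iso X' Y (f ≫ g) h = iso X Y g (h ≫ S.map f)
  naturality_right {X Y Y' : C} (g : X ⟶ Y) (u : Y ⟶ Y') (h : Y' ⟶ S.obj X) :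
    iso X Y' (g ≫ u) h = iso X Y g (u ≫ h)

namespace SerreFunctor

variable {k : Type t} [Field k] {C : Type u} [Category.{v} C] [Preadditive C] [Linear k C]
  [HasShift C ℤ]

/-- The Auslander-Reiten translate `τ = S ∘ [-1]`, so that `S ≅ τ[1]`. -/
noncomputable def tau (D : SerreFunctor k C) : C ⥤ C :=
  D.S ⋙ shiftFunctor C (-1 : ℤ)

instance (D : SerreFunctor k C) : D.tau.IsEquivalence := by
  have := D.isEquivalence
  dsimp only [tau]
  infer_instance

end SerreFunctor

/-- Equivalences preserve indecomposable objects. -/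
theorem indecomposable_obj_of_isEquivalence {C : Type u} [Category.{v} C] [Preadditive C]
    [HasBinaryBiproducts C] (F : C ⥤ C) [F.IsEquivalence] {X : C} (hX : Indecomposable X) :
    Indecomposable (F.obj X) := by
  have zero_of {W : C} (h : IsZero (F.inv.obj W)) : IsZero W :=
    ((F.map_isZero h).of_iso (F.asEquivalence.counitIso.app W).symm)
  have : PreservesBinaryBiproducts F.inv :=
    preservesBinaryBiproducts_of_preservesBinaryProducts F.inv
  refine ⟨fun h => hX.1 (((F.inv.map_isZero h)).of_iso (F.asEquivalence.unitIso.app X)), ?_⟩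
  intro Y Z e
  rcases hX.2 (F.inv.obj Y) (F.inv.obj Z)
    (F.asEquivalence.unitIso.app X ≪≫ F.inv.mapIso e ≪≫ F.inv.mapBiprod Y Z) with h | h
  · exact Or.inl (zero_of h)
  · exact Or.inr (zero_of h)

/-! ### The radical and irreducible morphisms -/

section Radical

variable {C : Type u} [Category.{v} C] [Preadditive C]

/-- `1 - fg` is invertible as soon as `1 - gf` is. -/
theorem isIso_id_sub_comp_swap {X Y : C} (f : X ⟶ Y) (g : Y ⟶ X) (h : IsIso (𝟙 Y - g ≫ f)) :
    IsIso (𝟙 X - f ≫ g) := by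
  have h₁ := IsIso.hom_inv_id (𝟙 Y - g ≫ f)
  have h₂ := IsIso.inv_hom_id (𝟙 Y - g ≫ f)
  set u := inv (𝟙 Y - g ≫ f) with hu
  have e₁ : g ≫ f ≫ u = u - 𝟙 Y := by
    simp only [Preadditive.sub_comp, Category.id_comp, Category.assoc] at h₁
    rw [← h₁]; abel
  have e₂ : u ≫ g ≫ f = u - 𝟙 Y := by
    simp only [Preadditive.comp_sub, Category.comp_id] at h₂
    rw [← h₂]; abel
  refine ⟨⟨𝟙 X + f ≫ u ≫ g, ?_, ?_⟩⟩
  · have : f ≫ g ≫ f ≫ u ≫ g = f ≫ u ≫ g - f ≫ g := by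
      rw [show f ≫ g ≫ f ≫ u ≫ g = f ≫ (g ≫ f ≫ u) ≫ g by simp, e₁]
      simp
    simp only [Preadditive.sub_comp, Preadditive.comp_add, Category.id_comp, Category.comp_id,
      Category.assoc, this]
    abel
  · have : f ≫ u ≫ g ≫ f ≫ g = f ≫ u ≫ g - f ≫ g := by
      rw [show f ≫ u ≫ g ≫ f ≫ g = f ≫ (u ≫ g ≫ f) ≫ g by simp, e₂]
      simp
    simp only [Preadditive.comp_sub, Preadditive.add_comp, Category.id_comp, Category.comp_id,
      Category.assoc, this]
    abel

variable (k : Type t) [Field k] [Linear k C]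

/-- The radical `rad(X, Y)` of the category `C`: the morphisms `f : X ⟶ Y` such that `1 - fg` is
invertible for every `g : Y ⟶ X`. -/
def catRad (X Y : C) : Submodule k (X ⟶ Y) where
  carrier := {f | ∀ g : Y ⟶ X, IsIso (𝟙 X - f ≫ g)}
  zero_mem' g := by
    simp only [zero_comp, sub_zero]
    infer_instance
  add_mem' := by
    intro a b ha hb g
    have h₁ := ha g
    have h₂ := hb (g ≫ inv (𝟙 X - a ≫ g))
    have h₃ : IsIso (𝟙 X - inv (𝟙 X - a ≫ g) ≫ b ≫ g) := by
      apply isIso_id_sub_comp_swap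
      simpa using h₂
    have : 𝟙 X - (a + b) ≫ g = (𝟙 X - a ≫ g) ≫ (𝟙 X - inv (𝟙 X - a ≫ g) ≫ b ≫ g) := by
      rw [Preadditive.comp_sub, IsIso.hom_inv_id_assoc, Category.comp_id, Preadditive.add_comp]
      abel
    rw [this]
    infer_instance
  smul_mem' := by
    intro c f hf g
    have := hf (c • g)
    simpa using this

/-- The square `rad²(X, Y)` of the radical: finite sums of compositions `X ⟶ Z ⟶ Y` of two
radical morphisms, with `Z` any object. -/
def catRadSq (X Y : C) : Submodule k (X ⟶ Y) :=
  Submodule.span k {h | ∃ (Z : C) (f : X ⟶ Z) (g : Z ⟶ Y),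
    f ∈ catRad k X Z ∧ g ∈ catRad k Z Y ∧ f ≫ g = h}

/-- The space `rad(X, Y) / rad²(X, Y)` of irreducible morphisms. -/
abbrev Irr (X Y : C) : Type _ :=
  catRad k X Y ⧸ (catRadSq k X Y).submoduleOf (catRad k X Y)

end Radical

/-! ### The Auslander-Reiten quiver -/

section ARQuiver

variable (k : Type t) [Field k] (C : Type u) [Category.{v} C] [Preadditive C] [Linear k C]
  [HasBinaryBiproducts C]

/-- Isomorphism of indecomposable objects. -/
abbrev indecSetoid : Setoid {X : C // Indecomposable X} where
  r X Y := Nonempty (X.1 ≅ Y.1)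
  iseqv := ⟨fun _ => ⟨Iso.refl _⟩, fun ⟨e⟩ => ⟨e.symm⟩, fun ⟨e⟩ ⟨f⟩ => ⟨e ≪≫ f⟩⟩

/-- The vertices of the Auslander-Reiten quiver: isomorphism classes of indecomposable objects. -/
def ARQuiver (_k : Type t) (C : Type u) [Category.{v} C] [Preadditive C]
    [HasBinaryBiproducts C] : Type u :=
  Quotient (indecSetoid C)

namespace ARQuiver

variable {C}

/-- The vertex given by an indecomposable object. -/
def mk (X : C) (hX : Indecomposable X) : ARQuiver k C :=
  Quotient.mk (indecSetoid C) ⟨X, hX⟩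

variable {k}

/-- A chosen indecomposable object in the isomorphism class `x`. -/
noncomputable def rep (x : ARQuiver k C) : C := (Quotient.out x).1

/-- There are `dim_k rad(X, Y)/rad²(X, Y)` arrows from `X` to `Y`. -/
noncomputable instance : Quiver (ARQuiver k C) where
  Hom x y := Fin (Module.finrank k (Irr k x.rep y.rep))

/-- The Auslander-Reiten translation on the vertices of the Auslander-Reiten quiver. -/
noncomputable def tau [HasShift C ℤ] (D : SerreFunctor k C) (x : ARQuiver k C) : ARQuiver k C :=
  mk k (D.tau.obj x.rep) (indecomposable_obj_of_isEquivalence D.tau (Quotient.out x).2)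

end ARQuiver

end ARQuiver

/-! ### Tubes -/

/-- The vertices of the translation quiver `ℤA_∞/⟨τ^r⟩`. The translation quiver `ℤA_∞` has as
vertices the pairs `(i, m)` with `i : ℤ`, `m : ℕ`, one arrow `(i, m) → (i, m + 1)` and one arrow
`(i, m + 1) → (i + 1, m)` for all `i` and `m`, no other arrows, and translation
`τ (i, m) = (i - 1, m)`. Dividing out `τ^r` means reading the first coordinate modulo `r`. -/
def TubeQuiver (r : ℕ) : Type := ZMod r × ℕ

namespace TubeQuiver

/-- An arrow either goes up, `(i, m) → (i, m + 1)`, or down, `(i, m + 1) → (i + 1, m)`;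
since it changes the second coordinate, there is at most one arrow between two vertices. -/
instance (r : ℕ) : Quiver (TubeQuiver r) where
  Hom x y := PLift ((y.1 = x.1 ∧ y.2 = x.2 + 1) ∨ (y.1 = x.1 + 1 ∧ x.2 = y.2 + 1))

/-- The translation of `ℤA_∞/⟨τ^r⟩`. -/
def tau {r : ℕ} (x : TubeQuiver r) : TubeQuiver r := (x.1 - 1, x.2)

end TubeQuiver

/-- A component `K` of the Auslander-Reiten quiver is a tube if, for some `r ≥ 1`, it is isomorphic
to `ℤA_∞/⟨τ^r⟩` as a translation quiver: there is a bijection on the vertices which respects the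
number of arrows between any two vertices, and the translation. -/
def IsTube {k : Type t} [Field k] {C : Type u} [Category.{v} C] [Preadditive C] [Linear k C]
    [HasBinaryBiproducts C] [HasShift C ℤ] (D : SerreFunctor k C)
    (K : Quiver.WeaklyConnectedComponent (ARQuiver k C)) : Prop :=
  ∃ r : ℕ, 1 ≤ r ∧
    ∃ e : TubeQuiver r ≃ {x : ARQuiver k C // Quiver.WeaklyConnectedComponent.mk x = K},
      (∀ x y : TubeQuiver r, Nonempty ((x ⟶ y) ≃ ((e x).1 ⟶ (e y).1))) ∧
      ∀ x : TubeQuiver r, (e x.tau).1 = (e x).1.tau D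

/-! One direction is formal: every vertex of `ℤA_∞/⟨τ^r⟩` is fixed by `τ^r`, and an isomorphism of
translation quivers carries this to the component.

For the converse, heredity forces every indecomposable object of the bounded derived category to be
concentrated in one degree, and a nonzero morphism between indecomposables raises the suitably
signed degree by 0 or 1. Serre duality yields Auslander-Reiten triangles `τY ⟶ M ⟶ Y ⟶ τY⟦1⟧`. The
multiplicities of the indecomposable summands of `M` count both the arrows into `Y` and the arrows
out of `τY`, so the quiver is locally finite and `τ` is a translation on it
(`ARQuiver.exists_arrows`).

Let a component contain a periodic vertex. Periodicity spreads along arrows, since a power of `τ`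
permutes the finitely many predecessors of a periodic vertex. The degree is constant on the
component, since `τ` never raises it and so cannot lower it along a cycle. Hence Hom(X, Y[-1])
vanishes within the component, and applying Hom(X, -) to an Auslander-Reiten triangle gives dim
Hom(X, τY) + dim Hom(X, Y) = Σ_Z #(Z → Y) · dim Hom(X, Z) + δ_{XY}. Summing over the `τ`-orbit of X
produces a positive function on the graph of `τ`-orbits that is additive except for a defect of one
at the orbit of X.

The component is infinite: in a finite one the nonzero connecting morphism X → τX[1], whose target
has larger degree, would keep factoring through radical morphisms among finitely many objects, and a
Nakayama argument would kill it (`eq_zero_of_forall_exists_radical_factorization`). An infinite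
connected locally finite graph with such a function for every base vertex is `A_∞`
(`exists_path_enumeration`): concavity, positivity and the defect exclude loops, multiple edges,
branching and the two-sided infinite line. A lift of the ray `A_∞` to the component then provides
the coordinates of a tube (`exists_tube_equiv`). -/

/-! ### Additive functions on locally finite graphs -/

/-- A positive midpoint-concave sequence does not decrease at the start if it is long enough. -/
theorem le_of_concave_of_pos {f : ℕ → ℕ} {N : ℕ} (hpos : ∀ i, 0 < f i)
    (hconc : ∀ i, i + 2 ≤ N → f i + f (i + 2) ≤ 2 * f (i + 1)) (hN : f 0 ≤ N) : f 0 ≤ f 1 := by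
  by_contra! h
  -- By concavity an initial drop repeats at every later step, so the value would have reached zero
  -- by index `f 0 ≤ N`.
  have step : ∀ i, i + 1 ≤ N → f (i + 1) + 1 ≤ f i := by
    intro i
    induction i with
    | zero => intro _; simpa using h
    | succ i ih =>
      intro hi
      have h₁ := ih (by omega)
      have h₂ := hconc i (by omega)
      change f (i + 2) + 1 ≤ f (i + 1)
      omega
  have key : ∀ i, i ≤ N → f i + i ≤ f 0 := by
    intro i
    induction i with
    | zero => simp
    | succ i ih =>
      intro hi
      have h₁ := ih (by omega)
      have h₂ := step i hi
      omega
  have h₁ := key N le_rfl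
  have h₂ := hpos N
  omega

/-- In a connected graph, a vertex at positive distance has a neighbour which is nearer. -/
theorem SimpleGraph.Connected.exists_adj_dist_eq {V : Type*} {G : SimpleGraph V}
    (hG : G.Connected) {v w : V} {n : ℕ} (h : G.dist v w = n + 1) :
    ∃ u, G.Adj u w ∧ G.dist v u = n := by
  obtain ⟨p, hp⟩ := hG.exists_walk_length_eq_dist w v
  cases p with
  | nil => simp at h
  | @cons _ u _ hadj q =>
    refine ⟨u, hadj.symm, ?_⟩
    have h₁ : q.length = n := by
      rw [SimpleGraph.dist_comm] at h
      simp only [SimpleGraph.Walk.length_cons] at hp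
      omega
    have h₂ : G.dist u v ≤ n := h₁ ▸ SimpleGraph.dist_le q
    have h₃ := hadj.diff_dist_adj (u := v)
    rw [SimpleGraph.dist_comm] at h₂
    omega

/-- An infinite connected locally finite graph has vertices at every distance. -/
theorem SimpleGraph.Connected.exists_dist_eq {V : Type*} [Infinite V] {G : SimpleGraph V}
    (hG : G.Connected) (hfin : ∀ v, (G.neighborSet v).Finite) (v : V) (n : ℕ) :
    ∃ w, G.dist v w = n := by
  have ball : ∀ n, {w | G.dist v w ≤ n}.Finite := by
    intro n
    induction n with
    | zero =>
      refine (Set.finite_singleton v).subset ?_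
      intro w hw
      have h₁ : G.dist v w = 0 := by simpa using hw
      exact (hG.dist_eq_zero_iff.1 h₁).symm
    | succ n ih =>
      refine (ih.union (ih.biUnion fun u _ => hfin u)).subset ?_
      intro w hw
      rcases Nat.lt_or_ge (G.dist v w) (n + 1) with h | h
      · exact Or.inl (Nat.lt_succ_iff.1 h)
      · obtain ⟨u, hu, hu'⟩ := hG.exists_adj_dist_eq (le_antisymm hw h)
        exact Or.inr (Set.mem_biUnion (show u ∈ {w | G.dist v w ≤ n} from hu'.le) hu)
  have down : ∀ d w, G.dist v w = n + d → ∃ w, G.dist v w = n := by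
    intro d
    induction d with
    | zero => intro w hw; exact ⟨w, hw⟩
    | succ d ih =>
      intro w hw
      obtain ⟨u, -, hu⟩ := hG.exists_adj_dist_eq hw
      exact ih u hu
  obtain ⟨w, hw⟩ := (ball n).infinite_compl.nonempty
  have : n ≤ G.dist v w := by
    have : ¬ G.dist v w ≤ n := hw
    omega
  obtain ⟨d, hd⟩ := Nat.exists_eq_add_of_le this
  exact down d w hd

/-- Every vertex is the end point of a geodesic. -/
theorem SimpleGraph.Connected.exists_geodesic {V : Type*} {G : SimpleGraph V}
    (hG : G.Connected) (v : V) (n : ℕ) : ∀ w, G.dist v w = n →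
    ∃ p : ℕ → V, p 0 = v ∧ p n = w ∧ (∀ i ≤ n, G.dist v (p i) = i) ∧
      ∀ i < n, G.Adj (p i) (p (i + 1)) := by
  induction n with
  | zero =>
    intro w hw
    have := hG.dist_eq_zero_iff.1 hw
    exact ⟨fun _ => v, rfl, this, by intro i hi; simp [Nat.le_zero.1 hi], by simp⟩
  | succ n ih =>
    intro w hw
    obtain ⟨u, hu, hu'⟩ := hG.exists_adj_dist_eq hw
    obtain ⟨p, h0, hn, hd, ha⟩ := ih u hu'
    refine ⟨fun i => if i ≤ n then p i else w, by simpa using h0, by simp, ?_, ?_⟩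
    · intro i hi
      dsimp only
      split_ifs with h
      · exact hd i h
      · rw [hw]; omega
    · intro i hi
      rcases Nat.lt_or_ge i n with h | h
      · simpa [h.le, Nat.succ_le_of_lt h] using ha i h
      · have : i = n := by omega
        subst this
        simpa [hn] using hu

section AdditiveFunction

variable {V : Type*} [DecidableEq V] {a : V → V →₀ ℕ} {b : V → V → ℕ}

/-- The number of neighbours bounds an additive function from below. -/
theorem le_two_mul_of_additive
    (hb : ∀ x y, 2 * b x y = ((a y).sum fun z n => n * b x z) + if x = y then 1 else 0)
    (x y : V) (s : Finset V) (hs : ∀ z ∈ s, a y z ≠ 0) :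
    (∑ z ∈ s, b x z) + (if x = y then 1 else 0) ≤ 2 * b x y := by
  rw [hb, Finsupp.sum]
  gcongr
  calc ∑ z ∈ s, b x z ≤ ∑ z ∈ s, a y z * b x z :=
        Finset.sum_le_sum fun z hz => Nat.le_mul_of_pos_left _ (Nat.pos_of_ne_zero (hs z hz))
    _ ≤ _ := Finset.sum_le_sum_of_subset fun z hz => Finsupp.mem_support_iff.2 (hs z hz)

/-- Additive functions are midpoint-concave along walks without backtracking. -/
theorem add_le_two_mul_of_additive
    (hb : ∀ x y, 2 * b x y = ((a y).sum fun z n => n * b x z) + if x = y then 1 else 0)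
    (x : V) {u y w : V} (hu : a y u ≠ 0) (hw : a y w ≠ 0) (huw : u ≠ w) :
    b x u + b x w ≤ 2 * b x y := by
  have := le_two_mul_of_additive hb x y {u, w} (by simp [hu, hw])
  rw [Finset.sum_pair huw] at this
  omega

/-- An infinite connected locally finite valued graph which has positive functions that are additive
except at a prescribed vertex is of type `A_∞`. -/
theorem exists_path_enumeration [Infinite V]
    (hsymm : ∀ x y, a x y ≠ 0 → a y x ≠ 0)
    (hconn : ∀ x y, Relation.ReflTransGen (fun u v => a u v ≠ 0) x y)
    (hpos : ∀ x y, 0 < b x y)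
    (hb : ∀ x y, 2 * b x y = ((a y).sum fun z n => n * b x z) + if x = y then 1 else 0) :
    ∃ v : ℕ ≃ V, ∀ m n, a (v m) (v n) = if n = m + 1 ∨ m = n + 1 then 1 else 0 := by
  let G : SimpleGraph V :=
    { Adj := fun u v => u ≠ v ∧ a u v ≠ 0
      symm := ⟨fun u v h => ⟨h.1.symm, hsymm _ _ h.2⟩⟩
      loopless := ⟨fun u h => h.1 rfl⟩ }
  have hG : G.Connected := by
    have : Nonempty V := inferInstance
    refine ⟨fun x y => ?_⟩
    induction hconn x y with
    | refl => exact SimpleGraph.Reachable.refl _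
    | @tail u w _ h ih =>
      by_cases huw : u = w
      · exact huw ▸ ih
      · exact ih.trans (SimpleGraph.Adj.reachable ⟨huw, h⟩)
  have hfin : ∀ v, (G.neighborSet v).Finite := fun v =>
    (a v).support.finite_toSet.subset fun w hw => by
      simpa using (show G.Adj v w from hw).2
  -- A geodesic from `v` never backtracks, so `b x` is concave along it; being longer than `b x v`,
  -- it cannot start with a drop.
  have first : ∀ x v, ∃ w, v ≠ w ∧ a v w ≠ 0 ∧ b x v ≤ b x w := by
    intro x v
    obtain ⟨w, hw⟩ := hG.exists_dist_eq hfin v (b x v + 1)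
    obtain ⟨p, h0, hn, hd, ha⟩ := hG.exists_geodesic v _ w hw
    refine ⟨p 1, h0 ▸ (ha 0 (by omega)).1, h0 ▸ (ha 0 (by omega)).2, ?_⟩
    have := le_of_concave_of_pos (f := fun i => b x (p i)) (N := b x v + 1) (fun i => hpos _ _)
      (fun i hi => add_le_two_mul_of_additive hb x (hsymm _ _ (ha i (by omega)).2)
        (ha (i + 1) (by omega)).2 ?_) (by simp [h0])
    · simpa [h0] using this
    · intro h
      have h₁ := hd i (by omega)
      have h₂ := hd (i + 2) hi
      rw [← h] at h₂
      omega
  have loops : ∀ v, a v v = 0 := by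
    intro v
    by_contra h
    obtain ⟨w, hvw, hw, hle⟩ := first v v
    have := le_two_mul_of_additive hb v v {v, w} (by simp [h, hw])
    rw [Finset.sum_pair hvw] at this
    simp only [if_true] at this
    omega
  -- Additivity at a neighbour `z` gives `b v v ≤ 2 * b v z`, while the neighbour `w` from `first`
  -- satisfies the stronger `b v v ≤ b v w`. Inserted into additivity at `v`, where the defect is
  -- one, this gives `2 * a v w + S < 4`, with `S` the total multiplicity of the other neighbours.
  have total : ∀ v, ((a v).sum fun _ n => n) ≤ 2 := by
    intro v
    obtain ⟨w, hvw, hw, hle⟩ := first v v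
    have h₁ := hb v v
    have h₂ : ∀ z ∈ (a v).support, b v v ≤ 2 * b v z := by
      intro z hz
      have := le_two_mul_of_additive hb v z {v} (by simpa using hsymm _ _ (by simpa using hz))
      simp only [Finset.sum_singleton] at this
      omega
    have hws : w ∈ (a v).support := by simpa using hw
    simp only [Finsupp.sum, if_true] at h₁ ⊢
    rw [← Finset.add_sum_erase _ _ hws] at h₁ ⊢
    have h₃ : (∑ z ∈ (a v).support.erase w, a v z) * b v v ≤
        2 * ∑ z ∈ (a v).support.erase w, a v z * b v z := by
      rw [Finset.sum_mul, Finset.mul_sum]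
      refine Finset.sum_le_sum fun z hz => ?_
      have := h₂ z (Finset.mem_of_mem_erase hz)
      nlinarith
    set S := ∑ z ∈ (a v).support.erase w, a v z
    set T := ∑ z ∈ (a v).support.erase w, a v z * b v z
    have h₄ : a v w * b v v ≤ a v w * b v w := Nat.mul_le_mul_left _ hle
    have h₅ : 1 ≤ a v w := Nat.pos_of_ne_zero hw
    have h₆ := hpos v v
    by_contra! h₇
    have h₈ : 4 * b v v ≤ (2 * a v w + S) * b v v := Nat.mul_le_mul_right _ (by omega)
    nlinarith
  have one : ∀ v w, a v w ≠ 0 → a v w = 1 := by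
    intro v w h
    obtain ⟨u, hvu, hu, hle⟩ := first v v
    have h₀ := total v
    have h₁ := hb v v
    simp only [Finsupp.sum, if_true] at h₀ h₁
    have key : ∀ z, a v z ≠ 0 → z ≠ u → a v z + a v u ≤ 2 := by
      intro z hz hzu
      refine le_trans ?_ h₀
      rw [← Finset.sum_pair hzu]
      exact Finset.sum_le_sum_of_subset fun t ht => by
        rcases Finset.mem_insert.1 ht with rfl | ht
        · simpa using hz
        · rw [Finset.mem_singleton.1 ht]; simpa using hu
    by_cases hwu : w = u
    · subst hwu
      have : a v w * b v w ≤ ∑ z ∈ (a v).support, a v z * b v z :=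
        Finset.single_le_sum (f := fun z => a v z * b v z) (fun _ _ => Nat.zero_le _)
          (by simpa using h)
      have h₆ := hpos v v
      by_contra hne
      have : 2 * b v w ≤ a v w * b v w := Nat.mul_le_mul_right _ (by omega)
      omega
    · have := key w h hwu
      omega
  have card : ∀ v, (a v).support.card ≤ 2 := by
    intro v
    refine le_trans ?_ (total v)
    rw [Finset.card_eq_sum_ones]
    exact Finset.sum_le_sum fun z hz => Nat.pos_of_ne_zero (by simpa using hz)
  have three : ∀ v x y z, a v x ≠ 0 → a v y ≠ 0 → a v z ≠ 0 → x ≠ y → y ≠ z → x ≠ z → False := by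
    intro v x y z hx hy hz hxy hyz hxz
    have h₁ : ({x, y, z} : Finset V) ⊆ (a v).support := by
      intro t ht
      simp only [Finset.mem_insert, Finset.mem_singleton] at ht
      rcases ht with rfl | rfl | rfl <;> simpa
    have h₂ := Finset.card_le_card h₁
    rw [Finset.card_eq_three.2 ⟨x, y, z, hxy, hxz, hyz, rfl⟩] at h₂
    have := card v
    omega
  -- a vertex with a single neighbour
  obtain ⟨v₀, hv₀⟩ : ∃ v, (a v).support.card ≤ 1 := by
    by_contra! hcon
    -- If every vertex had two neighbours, each edge would extend to an infinite walk without
    -- backtracking, and concavity would make `b x` nondecreasing along the edge. At a vertex `v`,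
    -- two neighbours with values at least `b v v` contradict the defect one.
    have next : ∀ x y, ∃ z, a y z ≠ 0 ∧ z ≠ x := by
      intro x y
      obtain ⟨z, hz, hzx⟩ := Finset.exists_mem_ne (hcon y) x
      exact ⟨z, by simpa using hz, hzx⟩
    choose f hf hf' using next
    have mono : ∀ x u w, a u w ≠ 0 → b x u ≤ b x w := by
      intro x u w h
      let q : ℕ → V × V := fun n => n.rec (u, w) fun _ s => (s.2, f s.1 s.2)
      have hadj : ∀ n, a (q n).1 (q n).2 ≠ 0 := by
        intro n
        induction n with
        | zero => exact h
        | succ n ih => exact hf _ _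
      exact le_of_concave_of_pos (f := fun i => b x (q i).1) (N := b x u) (fun i => hpos _ _)
        (fun i _ => add_le_two_mul_of_additive hb x (y := (q (i + 1)).1) (hsymm _ _ (hadj i))
          (hadj (i + 1)) (hf' (q i).1 (q i).2).symm) le_rfl
    obtain ⟨v⟩ : Nonempty V := inferInstance
    obtain ⟨x, hx, y, hy, hxy⟩ := Finset.one_lt_card.1 (hcon v)
    rw [Finsupp.mem_support_iff] at hx hy
    have := le_two_mul_of_additive hb v v {x, y} (by simp [hx, hy])
    rw [Finset.sum_pair hxy] at this
    have h₁ := mono v v x hx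
    have h₂ := mono v v y hy
    simp only [if_true] at this
    omega
  -- Since `v₀` has at most one neighbour and every other vertex at most two, each sphere around
  -- `v₀` is a single vertex; the distance from `v₀` is the required enumeration.
  have adj_of : ∀ {u w}, a u w ≠ 0 → G.Adj u w := fun {u w} h =>
    ⟨fun e => h (e ▸ loops u), h⟩
  have inj : ∀ n u w, G.dist v₀ u = n → G.dist v₀ w = n → u = w := by
    intro n
    induction n with
    | zero =>
      intro u w hu hw
      rw [← hG.dist_eq_zero_iff.1 hu, ← hG.dist_eq_zero_iff.1 hw]
    | succ n ih =>
      intro u w hu hw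
      by_contra huw
      obtain ⟨c, hc, hc'⟩ := hG.exists_adj_dist_eq hu
      obtain ⟨d, hd, hd'⟩ := hG.exists_adj_dist_eq hw
      obtain rfl := ih c d hc' hd'
      cases n with
      | zero =>
        obtain rfl := hG.dist_eq_zero_iff.1 hc'
        exact huw (Finset.card_le_one.1 hv₀ u (by simpa using hc.2) w (by simpa using hd.2))
      | succ n =>
        obtain ⟨e, he, he'⟩ := hG.exists_adj_dist_eq hc'
        refine three c e u w he.symm.2 hc.2 hd.2 ?_ huw ?_
        · rintro rfl; omega
        · rintro rfl; omega
  choose v hv using fun n => hG.exists_dist_eq hfin v₀ n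
  have hbij : Function.Bijective v := by
    refine ⟨fun m n h => ?_, fun w => ⟨G.dist v₀ w, inj _ _ _ (hv _) rfl⟩⟩
    rw [← hv m, ← hv n, h]
  have succ_adj : ∀ n, a (v n) (v (n + 1)) ≠ 0 := by
    intro n
    obtain ⟨u, hu, hu'⟩ := hG.exists_adj_dist_eq (hv (n + 1))
    rw [inj n u (v n) hu' (hv n)] at hu
    exact hu.2
  refine ⟨Equiv.ofBijective v hbij, fun m n => ?_⟩
  simp only [Equiv.ofBijective_apply]
  split_ifs with h
  · rcases h with rfl | rfl
    · exact one _ _ (succ_adj _)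
    · exact one _ _ (hsymm _ _ (succ_adj _))
  · by_contra hne
    have h₁ := (adj_of hne).diff_dist_adj (u := v₀)
    rw [hv, hv] at h₁
    have h₂ : m ≠ n := by
      rintro rfl
      exact hne (loops _)
    omega

end AdditiveFunction

/-! ### Periodic translation quivers with additive functions -/

/-- Two points of a fibre contribute to the value of `Finsupp.mapDomain`. -/
theorem Finsupp.add_le_mapDomain_apply {α β : Type*} (f : α → β) (s : α →₀ ℕ) {x y : α}
    (hxy : x ≠ y) (h : f x = f y) : s x + s y ≤ s.mapDomain f (f x) := by
  classical
  rw [Finsupp.mapDomain, Finsupp.sum_apply, Finsupp.sum]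
  have key : ∀ z, z ∈ ({x, y} : Finset α) → (Finsupp.single (f z) (s z)) (f x) = s z := by
    intro z hz
    rcases Finset.mem_insert.1 hz with rfl | hz
    · simp
    · rw [Finset.mem_singleton.1 hz, h]; simp
  rw [← Finset.sum_pair (f := fun z => s z) hxy, ← Finset.sum_congr rfl key]
  refine Finset.sum_le_sum_of_ne_zero fun z hz hne => ?_
  rw [key z hz] at hne
  simpa using hne

theorem Finsupp.exists_of_mapDomain_apply_ne_zero {α β : Type*} (f : α → β) (s : α →₀ ℕ) {b : β}
    (h : s.mapDomain f b ≠ 0) : ∃ x, f x = b ∧ s x ≠ 0 := by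
  classical
  have h₁ := Finsupp.mapDomain_support (Finsupp.mem_support_iff.2 h)
  obtain ⟨x, hx, hx'⟩ := Finset.mem_image.1 h₁
  exact ⟨x, hx', by simpa using hx⟩

theorem Finsupp.le_mapDomain_apply {α β : Type*} (f : α → β) (s : α →₀ ℕ) (x : α) :
    s x ≤ s.mapDomain f (f x) := by
  classical
  rw [Finsupp.mapDomain, Finsupp.sum_apply, Finsupp.sum]
  by_cases hx : s x = 0
  · simp [hx]
  · refine le_trans ?_ (Finset.single_le_sum (f := fun z => (Finsupp.single (f z) (s z)) (f x))
      (fun _ _ => Nat.zero_le _) (Finsupp.mem_support_iff.2 hx))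
    simp

section Orbit

variable {Γ : Type*} {τ : Equiv.Perm Γ} {N : Γ → Γ →₀ ℕ} {h : Γ → Γ → ℕ}

/-- The sum of the values `h z y` over the `τ`-orbit of `x`. -/
noncomputable def orbitSum (τ : Equiv.Perm Γ) (h : Γ → Γ → ℕ) (x y : Γ) : ℕ :=
  ∑ i ∈ Finset.range (Function.minimalPeriod τ x), h (τ^[i] x) y

theorem orbitSum_apply_right (hh : ∀ x y, h (τ x) (τ y) = h x y) (x y : Γ) :
    orbitSum τ h x (τ y) = orbitSum τ h x y := by
  have h₁ := Finset.sum_range_succ (fun i => h (τ^[i] x) (τ y)) (Function.minimalPeriod τ x)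
  have h₂ := Finset.sum_range_succ' (fun i => h (τ^[i] x) (τ y)) (Function.minimalPeriod τ x)
  simp only [Function.iterate_minimalPeriod, Function.iterate_succ_apply', hh,
    Function.iterate_zero_apply] at h₁ h₂
  rw [h₂] at h₁
  exact (Nat.add_right_cancel h₁).symm

theorem orbitSum_eq_of_sameCycle (hh : ∀ x y, h (τ x) (τ y) = h x y) (x : Γ) {y z : Γ}
    (hyz : τ.SameCycle y z) : orbitSum τ h x y = orbitSum τ h x z := by
  obtain ⟨i, rfl⟩ := hyz
  have key : ∀ (n : ℕ) (y : Γ), orbitSum τ h x ((τ ^ n) y) = orbitSum τ h x y := by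
    intro n
    induction n with
    | zero => simp
    | succ n ih => intro y; rw [pow_succ', Equiv.Perm.mul_apply, orbitSum_apply_right hh, ih]
  obtain ⟨n, rfl | rfl⟩ := i.eq_nat_or_neg
  · simp [key]
  · rw [← key n ((τ ^ (-(n : ℤ))) y)]
    simp

theorem exists_iterate_eq_of_sameCycle {x y : Γ} (hx : 0 < Function.minimalPeriod τ x)
    (hxy : τ.SameCycle x y) : ∃ i < Function.minimalPeriod τ x, τ^[i] x = y := by
  obtain ⟨j, rfl⟩ := hxy
  set p := Function.minimalPeriod τ x
  have hp : (p : ℤ) ≠ 0 := by exact_mod_cast hx.ne'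
  refine ⟨(j % p).toNat, ?_, ?_⟩
  · have := Int.emod_lt_of_pos j (b := p) (by exact_mod_cast hx)
    have := Int.emod_nonneg j hp
    omega
  · have h₁ : ((τ ^ p) ^ (j / p)) x = x := by
      apply Equiv.Perm.zpow_apply_eq_self_of_apply_eq_self
      rw [← Equiv.Perm.iterate_eq_pow]
      exact Function.iterate_minimalPeriod
    rw [Equiv.Perm.iterate_eq_pow, ← zpow_natCast, Int.toNat_of_nonneg (Int.emod_nonneg j hp)]
    conv_rhs => rw [← Int.emod_add_mul_ediv j p, zpow_add, Equiv.Perm.mul_apply, zpow_mul,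
      zpow_natCast, h₁]

/-- The additivity relation is summed over the orbit of `x`. Both terms on the left become the same
orbit sum, since this is `τ`-invariant in `y`, and the Kronecker deltas add up to one exactly when
`y` lies in the orbit. -/
theorem two_mul_orbitSum [DecidableEq Γ] [DecidableRel τ.SameCycle]
    (hh : ∀ x y, h (τ x) (τ y) = h x y)
    (hadd : ∀ x y, h x (τ y) + h x y = ((N y).sum fun z n => n * h x z) + if x = y then 1 else 0)
    {x : Γ} (hx : 0 < Function.minimalPeriod τ x) (y : Γ) :
    2 * orbitSum τ h x y =
      ((N y).sum fun z n => n * orbitSum τ h x z) + if τ.SameCycle x y then 1 else 0 := by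
  have h₁ : (∑ i ∈ Finset.range (Function.minimalPeriod τ x), if τ^[i] x = y then 1 else 0) =
      if τ.SameCycle x y then 1 else 0 := by
    split_ifs with hxy
    · obtain ⟨i, hi, rfl⟩ := exists_iterate_eq_of_sameCycle hx hxy
      rw [Finset.sum_eq_single i]
      · simp
      · intro j hj hji
        rw [if_neg]
        intro he
        exact hji (Function.iterate_injOn_Iio_minimalPeriod (by simpa using hj) hi he)
      · intro hi'
        simp [hi] at hi'
    · refine Finset.sum_eq_zero fun i _ => if_neg ?_
      rintro rfl
      exact hxy ⟨i, by rw [zpow_natCast, Equiv.Perm.iterate_eq_pow]⟩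
  rw [two_mul]
  nth_rw 1 [← orbitSum_apply_right hh]
  rw [orbitSum, orbitSum, ← Finset.sum_add_distrib, Finset.sum_congr rfl fun i _ => hadd _ _,
    Finset.sum_add_distrib, h₁]
  congr 1
  simp only [Finsupp.sum, orbitSum, Finset.mul_sum]
  rw [Finset.sum_comm]

/-- The orbit sums of a function that is additive and positive on the diagonal are positive. -/
theorem orbitSum_pos [DecidableEq Γ]
    (hτ : ∀ y z, N y z = N z (τ y))
    (hh : ∀ x y, h (τ x) (τ y) = h x y) (hne : ∀ x, h x x ≠ 0)
    (hadd : ∀ x y, h x (τ y) + h x y = ((N y).sum fun z n => n * h x z) + if x = y then 1 else 0)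
    (hconn : ∀ x y, Relation.EqvGen (fun u v => N u v ≠ 0) x y)
    {x : Γ} (hx : 0 < Function.minimalPeriod τ x) (y : Γ) : 0 < orbitSum τ h x y := by
  classical
  -- A zero of a nonnegative function satisfying the relation forces zeros at all predecessors, and
  -- by the translation also at all successors. Connectedness would carry it to `x`, where `h x x`
  -- contributes.
  have step : ∀ u v, N u v ≠ 0 → orbitSum τ h x u = 0 → orbitSum τ h x v = 0 := by
    intro u v huv hu
    have h₁ := two_mul_orbitSum hh hadd hx u
    rw [hu, Finsupp.sum] at h₁
    have h₂ : ∑ z ∈ (N u).support, N u z * orbitSum τ h x z = 0 := by omega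
    have := Finset.sum_eq_zero_iff.1 h₂ v (by simpa using huv)
    simpa [huv] using this
  have step' : ∀ u v, N u v ≠ 0 → (orbitSum τ h x u = 0 ↔ orbitSum τ h x v = 0) := by
    intro u v huv
    refine ⟨step u v huv, fun hv => ?_⟩
    rw [hτ] at huv
    rw [← orbitSum_apply_right hh]
    exact step _ _ huv hv
  have all : ∀ u v, orbitSum τ h x u = 0 ↔ orbitSum τ h x v = 0 := by
    intro u v
    induction hconn u v with
    | rel _ _ h => exact step' _ _ h
    | refl => rfl
    | symm _ _ _ ih => exact ih.symm
    | trans _ _ _ _ _ ih₁ ih₂ => exact ih₁.trans ih₂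
  rw [Nat.pos_iff_ne_zero]
  intro hy
  have h₁ := (all y x).1 hy
  rw [orbitSum, Finset.sum_eq_zero_iff] at h₁
  exact hne x (h₁ 0 (Finset.mem_range.2 hx))

/-- The orbit quiver of an infinite periodic translation quiver with additive functions is of type
`A_∞`. -/
theorem exists_orbit_enumeration [DecidableEq Γ] [Infinite Γ]
    (hτ : ∀ y z, N y z = N z (τ y))
    (hh : ∀ x y, h (τ x) (τ y) = h x y) (hne : ∀ x, h x x ≠ 0)
    (hadd : ∀ x y, h x (τ y) + h x y = ((N y).sum fun z n => n * h x z) + if x = y then 1 else 0)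
    (hconn : ∀ x y, Relation.EqvGen (fun u v => N u v ≠ 0) x y)
    (hper : ∀ x, 0 < Function.minimalPeriod τ x) :
    ∃ v : ℕ ≃ Quotient (Equiv.Perm.SameCycle.setoid τ), ∀ m n y, Quotient.mk _ y = v m →
      (N y).mapDomain (Quotient.mk (Equiv.Perm.SameCycle.setoid τ)) (v n) =
        if n = m + 1 ∨ m = n + 1 then 1 else 0 := by
  classical
  have hNτ : ∀ y z, N (τ y) (τ z) = N y z := fun y z => by rw [hτ y z, hτ z (τ y)]
  let π : Γ → Quotient (Equiv.Perm.SameCycle.setoid τ) := Quotient.mk _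
  have hπτ : ∀ y, π (τ y) = π y := fun y =>
    Quotient.sound (show τ.SameCycle (τ y) y by simp [Equiv.Perm.SameCycle.refl])
  -- The valued graph on the orbits pushes `N y` forward along `π`; invariance under `τ` makes this
  -- independent of the chosen representative `y`.
  have hinv : ∀ y, (N (τ y)).mapDomain π = (N y).mapDomain π := by
    intro y
    have : N (τ y) = (N y).mapDomain τ := by
      ext z
      obtain ⟨z, rfl⟩ := τ.surjective z
      rw [Finsupp.mapDomain_apply τ.injective, hNτ]
    rw [this, ← Finsupp.mapDomain_comp]
    congr 1
    exact funext hπτ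
  have hinv' : ∀ y z, τ.SameCycle y z → (N y).mapDomain π = (N z).mapDomain π := by
    rintro y _ ⟨i, rfl⟩
    have key : ∀ (n : ℕ) (y : Γ), (N ((τ ^ n) y)).mapDomain π = (N y).mapDomain π := by
      intro n
      induction n with
      | zero => simp
      | succ n ih => intro y; rw [pow_succ', Equiv.Perm.mul_apply, hinv, ih]
    obtain ⟨n, rfl | rfl⟩ := i.eq_nat_or_neg
    · simp [key]
    · rw [← key n ((τ ^ (-(n : ℤ))) y)]
      simp
  let a : Quotient (Equiv.Perm.SameCycle.setoid τ) → _ →₀ ℕ :=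
    fun Y => (N Y.out).mapDomain π
  have ha : ∀ y, a (π y) = (N y).mapDomain π := fun y =>
    hinv' _ _ (Quotient.exact (Quotient.out_eq (π y)))
  let b : Quotient (Equiv.Perm.SameCycle.setoid τ) → Quotient (Equiv.Perm.SameCycle.setoid τ) → ℕ :=
    fun X Y => orbitSum τ h X.out Y.out
  have hout : ∀ y, τ.SameCycle (π y).out y := fun y => Quotient.exact (Quotient.out_eq (π y))
  have hsymm : ∀ X Y, a X Y ≠ 0 → a Y X ≠ 0 := by
    intro X Y hXY
    obtain ⟨z, rfl, hz⟩ := Finsupp.exists_of_mapDomain_apply_ne_zero _ _ hXY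
    rw [hτ] at hz
    rw [ha]
    have := Finsupp.le_mapDomain_apply π (N z) (τ X.out)
    rw [hπτ, show π X.out = X from Quotient.out_eq X] at this
    omega
  have hconn' : ∀ X Y, Relation.ReflTransGen (fun u v => a u v ≠ 0) X Y := by
    intro X Y
    obtain ⟨x, rfl⟩ := Quotient.exists_rep X
    obtain ⟨y, rfl⟩ := Quotient.exists_rep Y
    have hrel : ∀ u v, N u v ≠ 0 → a (π u) (π v) ≠ 0 := by
      intro u v huv
      rw [ha]
      have := Finsupp.le_mapDomain_apply π (N u) v
      omega
    change Relation.ReflTransGen _ (π x) (π y)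
    have : Relation.ReflTransGen (fun u v => a u v ≠ 0) (π x) (π y) ∧
        Relation.ReflTransGen (fun u v => a u v ≠ 0) (π y) (π x) := by
      induction hconn x y with
      | rel _ _ h =>
        exact ⟨Relation.ReflTransGen.single (hrel _ _ h),
          Relation.ReflTransGen.single (hsymm _ _ (hrel _ _ h))⟩
      | refl => exact ⟨Relation.ReflTransGen.refl, Relation.ReflTransGen.refl⟩
      | symm _ _ _ ih => exact ih.symm
      | trans _ _ _ _ _ ih₁ ih₂ => exact ⟨ih₁.1.trans ih₂.1, ih₂.2.trans ih₁.2⟩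
    exact this.1
  have hinf : Infinite (Quotient (Equiv.Perm.SameCycle.setoid τ)) := by
    by_contra hfin
    rw [not_infinite_iff_finite] at hfin
    have : (Set.univ : Set Γ).Finite := by
      refine (Set.finite_iUnion (f := fun X : Quotient (Equiv.Perm.SameCycle.setoid τ) =>
        (fun i : ℕ => τ^[i] X.out) '' Set.Iio (Function.minimalPeriod τ X.out))
        fun X => (Set.finite_Iio _).image _).subset ?_
      intro y _
      obtain ⟨i, hi, hi'⟩ := exists_iterate_eq_of_sameCycle (hper _) (hout y)
      exact Set.mem_iUnion.2 ⟨π y, i, hi, hi'⟩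
    exact Set.infinite_univ this
  obtain ⟨v, hv⟩ := exists_path_enumeration (a := a) (b := b) hsymm hconn'
    (fun X Y => orbitSum_pos hτ hh hne hadd hconn (hper _) _) (by
      intro X Y
      rw [two_mul_orbitSum hh hadd (hper _)]
      congr 1
      · rw [Finsupp.sum_mapDomain_index (by simp) (by intros; rw [add_mul])]
        refine Finsupp.sum_congr fun z _ => ?_
        exact congrArg _ (orbitSum_eq_of_sameCycle hh _ (hout z)).symm
      · congr 1
        rw [← Quotient.out_equiv_out]
        rfl)
  refine ⟨v, fun m n y hy => ?_⟩
  rw [← hv m n, ← hy]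
  exact congrFun (congrArg _ (ha y).symm) _

/-- An infinite connected periodic translation quiver with additive functions is a tube. -/
theorem exists_tube_equiv [DecidableEq Γ] [Infinite Γ]
    (hτ : ∀ y z, N y z = N z (τ y))
    (hh : ∀ x y, h (τ x) (τ y) = h x y) (hne : ∀ x, h x x ≠ 0)
    (hadd : ∀ x y, h x (τ y) + h x y = ((N y).sum fun z n => n * h x z) + if x = y then 1 else 0)
    (hconn : ∀ x y, Relation.EqvGen (fun u v => N u v ≠ 0) x y)
    (hper : ∀ x, 0 < Function.minimalPeriod τ x) :
    ∃ r : ℕ, 1 ≤ r ∧ ∃ e : TubeQuiver r ≃ Γ,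
      (∀ x y : TubeQuiver r, N (e y) (e x) =
        if (y.1 = x.1 ∧ y.2 = x.2 + 1) ∨ (y.1 = x.1 + 1 ∧ x.2 = y.2 + 1) then 1 else 0) ∧
      ∀ x : TubeQuiver r, e x.tau = τ (e x) := by
  have hNτ : ∀ y z, N (τ y) (τ z) = N y z := fun y z => by rw [hτ y z, hτ z (τ y)]
  have hNpow : ∀ (j : ℤ) y z, N ((τ ^ j) y) ((τ ^ j) z) = N y z := by
    have key : ∀ (n : ℕ) y z, N ((τ ^ n) y) ((τ ^ n) z) = N y z := by
      intro n
      induction n with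
      | zero => simp
      | succ n ih => intro y z; simp only [pow_succ', Equiv.Perm.mul_apply, hNτ, ih]
    intro j y z
    obtain ⟨n, rfl | rfl⟩ := j.eq_nat_or_neg
    · simp [key]
    · rw [← key n ((τ ^ (-(n : ℤ))) y)]
      simp
  obtain ⟨v, hv⟩ := exists_orbit_enumeration hτ hh hne hadd hconn hper
  set π : Γ → Quotient (Equiv.Perm.SameCycle.setoid τ) := Quotient.mk _ with hπ
  have hπτ : ∀ (j : ℤ) y, π ((τ ^ j) y) = π y := fun j y =>
    Quotient.sound (show τ.SameCycle ((τ ^ j) y) y by simp [Equiv.Perm.SameCycle.refl])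
  have hπτ' : ∀ y, π (τ y) = π y := fun y => by simpa using hπτ 1 y
  have le_one : ∀ y z, N y z ≤ 1 := by
    intro y z
    obtain ⟨m, hm⟩ := v.surjective (π y)
    obtain ⟨n, hn⟩ := v.surjective (π z)
    have h₁ := hv m n y hm.symm
    rw [hn] at h₁
    refine (Finsupp.le_mapDomain_apply π (N y) z).trans ?_
    rw [h₁]
    split_ifs <;> simp
  -- The orbit graph has no multiple edges, so a vertex has at most one predecessor in each orbit.
  have uniq : ∀ y z z', π z = π z' → N y z ≠ 0 → N y z' ≠ 0 → z = z' := by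
    intro y z z' hzz hz hz'
    by_contra hne'
    obtain ⟨m, hm⟩ := v.surjective (π y)
    obtain ⟨n, hn⟩ := v.surjective (π z)
    have h₁ := hv m n y hm.symm
    have h₂ := Finsupp.add_le_mapDomain_apply π (N y) hne' hzz
    rw [← hn, h₁] at h₂
    split_ifs at h₂ <;> omega
  have hstep : ∀ m x, π x = v m → ∃ y, π y = v (m + 1) ∧ N y x ≠ 0 := by
    intro m x hx
    have h₁ := hv m (m + 1) x hx
    rw [if_pos (Or.inl rfl)] at h₁
    obtain ⟨z, hz, hz'⟩ := Finsupp.exists_of_mapDomain_apply_ne_zero _ _ (h₁.trans_ne one_ne_zero)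
    refine ⟨τ⁻¹ z, ?_, ?_⟩
    · rw [← hπτ']; simpa using hz
    · rw [hτ]; simpa using hz'
  obtain ⟨x₀, hx₀⟩ := Quotient.exists_rep (v 0)
  choose! f hf hf' using hstep
  -- A ray `q 0 → q 1 → q 2 → ⋯` lifting the path of orbits; `N y z` counts the arrows from `z` to
  -- `y`.
  let q : ℕ → Γ := fun n => n.rec x₀ fun m x => f m x
  have hq : ∀ m, π (q m) = v m := by
    intro m
    induction m with
    | zero => exact hx₀
    | succ m ih => exact hf m _ ih
  have hqq : ∀ m, N (q (m + 1)) (q m) ≠ 0 := fun m => hf' m _ (hq m)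
  set r := Function.minimalPeriod τ x₀
  have hr : 1 ≤ r := hper x₀
  -- By `uniq`, a power of `τ` fixing one end of an arrow of the ray fixes the other end, so all
  -- orbits have the same period `r`.
  have fix_succ : ∀ m (j : ℤ), (τ ^ j) (q m) = q m ↔ (τ ^ j) (q (m + 1)) = q (m + 1) := by
    intro m j
    have h₁ := hqq m
    rw [← hNpow j] at h₁
    constructor
    · intro he
      rw [he, hτ] at h₁
      have h₂ := hqq m
      rw [hτ] at h₂
      exact τ.injective (uniq _ _ _ (by rw [hπτ', hπτ', hπτ]) h₁ h₂)
    · intro he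
      rw [he] at h₁
      exact uniq _ _ _ (hπτ _ _) h₁ (hqq m)
  have fix : ∀ m (j : ℤ), (τ ^ j) (q m) = q m ↔ (r : ℤ) ∣ j := by
    intro m j
    induction m with
    | zero =>
      have key : ∀ n : ℕ, (τ ^ n) x₀ = x₀ ↔ r ∣ n := by
        intro n
        rw [← Function.isPeriodicPt_iff_minimalPeriod_dvd, Function.IsPeriodicPt,
          Function.IsFixedPt, Equiv.Perm.iterate_eq_pow]
      change (τ ^ j) x₀ = x₀ ↔ _
      obtain ⟨n, rfl | rfl⟩ := j.eq_nat_or_neg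
      · rw [zpow_natCast, key, Int.natCast_dvd_natCast]
      · rw [dvd_neg, Int.natCast_dvd_natCast, ← key, zpow_neg, zpow_natCast,
          Equiv.Perm.inv_eq_iff_eq, eq_comm]
    | succ m ih => rw [← fix_succ, ih]
  have pow_eq : ∀ m (i j : ℤ), (τ ^ i) (q m) = (τ ^ j) (q m) ↔ (i : ZMod r) = (j : ZMod r) := by
    intro m i j
    rw [ZMod.intCast_eq_intCast_iff_dvd_sub, ← fix m, show j - i = -i + j by ring, zpow_add,
      Equiv.Perm.mul_apply, zpow_neg, Equiv.Perm.inv_eq_iff_eq, eq_comm]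
  -- The exponent is negative because the translation of the tube lowers the first coordinate.
  let e : ZMod r × ℕ → Γ := fun x => (τ ^ (-(x.1.cast : ℤ))) (q x.2)
  have he : ∀ (j : ℤ) m, e ((j : ZMod r), m) = (τ ^ (-j)) (q m) := by
    intro j m
    refine (pow_eq _ _ _).2 ?_
    push_cast
    simp
  have hπe : ∀ x, π (e x) = v x.2 := fun x => (hπτ _ _).trans (hq _)
  have hbij : Function.Bijective e := by
    constructor
    · rintro ⟨i, m⟩ ⟨i', m'⟩ hxy
      have h₁ := congrArg π hxy
      rw [hπe, hπe] at h₁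
      obtain rfl : m = m' := v.injective h₁
      obtain ⟨j, rfl⟩ := ZMod.intCast_surjective i
      obtain ⟨j', rfl⟩ := ZMod.intCast_surjective i'
      rw [he, he, pow_eq] at hxy
      push_cast at hxy
      rw [neg_inj.1 hxy]
    · intro y
      obtain ⟨m, hm⟩ := v.surjective (π y)
      obtain ⟨j, hj⟩ : τ.SameCycle (q m) y := Quotient.exact ((hq m).trans hm)
      refine ⟨(((-j : ℤ) : ZMod r), m), ?_⟩
      rw [he, neg_neg, hj]
  have hN : ∀ (i i' : ZMod r) (m m' : ℕ), N (e (i', m')) (e (i, m)) =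
      if (i' = i ∧ m' = m + 1) ∨ (i' = i + 1 ∧ m = m' + 1) then 1 else 0 := by
    intro i i' m m'
    obtain ⟨j, rfl⟩ := ZMod.intCast_surjective i
    obtain ⟨j', rfl⟩ := ZMod.intCast_surjective i'
    by_cases hm : m' = m + 1
    · subst hm
      have href : N (e ((j' : ZMod r), m + 1)) (e ((j' : ZMod r), m)) ≠ 0 := by
        rw [he, he, hNpow]
        exact hqq m
      by_cases hj : (j' : ZMod r) = j
      · rw [if_pos (Or.inl ⟨hj, rfl⟩), ← hj]
        exact le_antisymm (le_one _ _) (Nat.pos_of_ne_zero href)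
      · rw [if_neg (by rintro (⟨h₁, -⟩ | ⟨-, h₁⟩) <;> [exact hj h₁; omega])]
        by_contra h₁
        have h₂ := hbij.injective (uniq _ _ _ (by rw [hπe, hπe]) h₁ href)
        exact hj (congrArg Prod.fst h₂).symm
    by_cases hm' : m = m' + 1
    · subst hm'
      -- The downward arrows are the partners under `N y z = N z (τ y)` of the arrows of the
      -- translated rays.
      have href : N (e ((j' : ZMod r), m')) (e (((j' - 1 : ℤ) : ZMod r), m' + 1)) ≠ 0 := by
        rw [he, he, show -(j' - 1) = -j' + 1 by ring, zpow_add, Equiv.Perm.mul_apply, hNpow,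
          zpow_one, ← hτ]
        exact hqq m'
      by_cases hj : (j' : ZMod r) = j + 1
      · rw [if_pos (Or.inr ⟨hj, rfl⟩)]
        have : (j : ZMod r) = ((j' - 1 : ℤ) : ZMod r) := by
          push_cast
          rw [hj]
          ring
        rw [this]
        exact le_antisymm (le_one _ _) (Nat.pos_of_ne_zero href)
      · rw [if_neg (by rintro (⟨-, h₁⟩ | ⟨h₁, -⟩) <;> [exact hm h₁; exact hj h₁])]
        by_contra h₁
        have h₂ := hbij.injective (uniq _ _ _ (by rw [hπe, hπe]) h₁ href)
        have h₃ : (j : ZMod r) = ((j' - 1 : ℤ) : ZMod r) := congrArg Prod.fst h₂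
        apply hj
        rw [h₃]
        push_cast
        ring
    · rw [if_neg (by rintro (⟨-, h₁⟩ | ⟨-, h₁⟩) <;> [exact hm h₁; exact hm' h₁])]
      have h₁ := Finsupp.le_mapDomain_apply π (N (e ((j' : ZMod r), m'))) (e ((j : ZMod r), m))
      rw [hπe, hv m' m _ (hπe _), if_neg (by omega)] at h₁
      exact Nat.le_zero.1 h₁
  refine ⟨r, hr, Equiv.ofBijective (α := TubeQuiver r) e hbij,
    fun x y => hN x.1 y.1 x.2 y.2, ?_⟩
  have ht : ∀ (i : ZMod r) (m : ℕ), e (i - 1, m) = τ (e (i, m)) := by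
    intro i m
    obtain ⟨j, rfl⟩ := ZMod.intCast_surjective i
    have : (j : ZMod r) - 1 = ((j - 1 : ℤ) : ZMod r) := by push_cast; rfl
    rw [this, he, he, show -(j - 1) = 1 + -j by ring, zpow_add, Equiv.Perm.mul_apply, zpow_one]
  exact fun x => ht x.1 x.2

end Orbit

/-! ### The radical of a linear category -/

section RadicalLemmas

universe t' v' u'

variable {k : Type t'} [Field k] {C : Type u'} [Category.{v'} C] [Preadditive C] [Linear k C]

theorem mem_catRad_iff_swap {X Y : C} {f : X ⟶ Y} :
    f ∈ catRad k X Y ↔ ∀ g : Y ⟶ X, IsIso (𝟙 Y - g ≫ f) :=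
  ⟨fun h g => isIso_id_sub_comp_swap _ _ (h g), fun h g => isIso_id_sub_comp_swap _ _ (h g)⟩

theorem comp_mem_catRad_right {X Y Z : C} {f : X ⟶ Y} (hf : f ∈ catRad k X Y) (h : Y ⟶ Z) :
    f ≫ h ∈ catRad k X Z := fun g => by
  rw [Category.assoc]
  exact hf (h ≫ g)

theorem comp_mem_catRad_left {X Y Z : C} {f : X ⟶ Y} (hf : f ∈ catRad k X Y) (h : Z ⟶ X) :
    h ≫ f ∈ catRad k Z Y := mem_catRad_iff_swap.2 fun g => by
  rw [← Category.assoc]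
  exact mem_catRad_iff_swap.1 hf (g ≫ h)

theorem mem_catRad_of_forall_comp {X Y : C} {f : X ⟶ Y}
    (h : ∀ g : Y ⟶ X, f ≫ g ∈ catRad k X X) : f ∈ catRad k X Y := fun g => by
  simpa using h g (𝟙 X)

theorem mem_catRad_of_forall_comp' {X Y : C} {f : X ⟶ Y}
    (h : ∀ g : Y ⟶ X, g ≫ f ∈ catRad k Y Y) : f ∈ catRad k X Y :=
  mem_catRad_iff_swap.2 fun g => by simpa using h g (𝟙 Y)

theorem id_notMem_catRad {X : C} (hX : ¬ IsZero X) : 𝟙 X ∉ catRad k X X := fun h => by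
  have h₁ := h (𝟙 X)
  simp only [Category.comp_id, sub_self] at h₁
  apply hX
  rw [IsZero.iff_id_eq_zero, ← IsIso.hom_inv_id (0 : X ⟶ X), zero_comp]

theorem notMem_catRad_of_isIso {X Y : C} (hX : ¬ IsZero X) (f : X ⟶ Y) [IsIso f] :
    f ∉ catRad k X Y := fun h => id_notMem_catRad (k := k) hX (by
  simpa using comp_mem_catRad_right h (inv f))

/-- The endomorphism algebra of `X` is local with residue field `k`. -/
def HasSplitLocalEnd (k : Type t') [Field k] {C : Type u'} [Category.{v'} C] [Preadditive C]
    [Linear k C] (X : C) : Prop :=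
  ¬ IsZero X ∧ ∀ f : X ⟶ X, ∃ c : k, f - c • 𝟙 X ∈ catRad k X X

namespace HasSplitLocalEnd

theorem isIso_of_notMem {X : C} (hX : HasSplitLocalEnd k X) {f : X ⟶ X}
    (hf : f ∉ catRad k X X) : IsIso f := by
  obtain ⟨c, hc⟩ := hX.2 f
  have hc0 : c ≠ 0 := by
    rintro rfl
    exact hf (by simpa using hc)
  have h₁ := hc (-(c⁻¹ • 𝟙 X))
  have h₂ : 𝟙 X - (f - c • 𝟙 X) ≫ (-(c⁻¹ • 𝟙 X)) = c⁻¹ • f := by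
    simp [smul_sub, smul_smul, hc0]
  rw [h₂] at h₁
  refine ⟨c⁻¹ • inv (c⁻¹ • f), ?_, ?_⟩
  · have := IsIso.hom_inv_id (c⁻¹ • f)
    rw [Linear.smul_comp] at this
    rw [Linear.comp_smul, this]
  · have := IsIso.inv_hom_id (c⁻¹ • f)
    rw [Linear.comp_smul] at this
    rw [Linear.smul_comp, this]

/-- A nonradical morphism between objects with local endomorphism rings is invertible. -/
theorem isIso_of_notMem' {X Y : C} (hX : HasSplitLocalEnd k X) (hY : HasSplitLocalEnd k Y)
    {f : X ⟶ Y} (hf : f ∉ catRad k X Y) : IsIso f := by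
  obtain ⟨g, hg⟩ : ∃ g : Y ⟶ X, f ≫ g ∉ catRad k X X := by
    by_contra! h
    exact hf (mem_catRad_of_forall_comp h)
  have h₁ := hX.isIso_of_notMem hg
  have h₂ : g ≫ f ∉ catRad k Y Y := by
    intro h
    have h₃ := comp_mem_catRad_right (comp_mem_catRad_left h f) g
    have : f ≫ (g ≫ f) ≫ g = (f ≫ g) ≫ (f ≫ g) := by simp
    simp only [Category.assoc] at h₃ this
    exact notMem_catRad_of_isIso (k := k) hX.1 ((f ≫ g) ≫ (f ≫ g)) (by simpa using h₃)
  have h₃ := hY.isIso_of_notMem h₂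
  have h₄ : IsSplitMono f := ⟨⟨⟨g ≫ inv (f ≫ g), by rw [← Category.assoc, IsIso.hom_inv_id]⟩⟩⟩
  have h₅ : IsSplitEpi f := ⟨⟨⟨inv (g ≫ f) ≫ g, by rw [Category.assoc, IsIso.inv_hom_id]⟩⟩⟩
  exact isIso_of_mono_of_isSplitEpi f

theorem mem_catRad_of_isEmpty_iso {X Y : C} (hX : HasSplitLocalEnd k X)
    (hY : HasSplitLocalEnd k Y) (h : IsEmpty (X ≅ Y)) (f : X ⟶ Y) : f ∈ catRad k X Y := by
  by_contra hf
  have := hX.isIso_of_notMem' hY hf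
  exact h.false (asIso f)

theorem finrank_quotient_of_iso {X Y : C} (hX : HasSplitLocalEnd k X) (e : X ≅ Y) :
    Module.finrank k ((X ⟶ Y) ⧸ catRad k X Y) = 1 := by
  refine finrank_eq_one_iff'.2 ⟨Submodule.Quotient.mk e.hom, ?_, ?_⟩
  · rw [Ne, Submodule.Quotient.mk_eq_zero]
    exact notMem_catRad_of_isIso hX.1 e.hom
  · intro w
    obtain ⟨f, rfl⟩ := Submodule.Quotient.mk_surjective _ w
    obtain ⟨c, hc⟩ := hX.2 (f ≫ e.inv)
    refine ⟨c, ?_⟩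
    rw [← Submodule.Quotient.mk_smul, eq_comm, Submodule.Quotient.eq]
    have := comp_mem_catRad_right hc e.hom
    simpa using this

/-- There is a linear functional on the endomorphism algebra whose kernel is the radical. -/
theorem exists_functional {X : C} (hX : HasSplitLocalEnd k X) :
    ∃ l : (X ⟶ X) →ₗ[k] k, LinearMap.ker l = catRad k X X := by
  have h₁ := hX.finrank_quotient_of_iso (Iso.refl X)
  have : Module.Finite k ((X ⟶ X) ⧸ catRad k X X) := Module.finite_of_finrank_pos (by omega)
  let e : ((X ⟶ X) ⧸ catRad k X X) ≃ₗ[k] k := LinearEquiv.ofFinrankEq _ _ (by simp [h₁])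
  refine ⟨e.toLinearMap ∘ₗ (catRad k X X).mkQ, ?_⟩
  rw [LinearEquiv.ker_comp, Submodule.ker_mkQ]

end HasSplitLocalEnd

/-- The two sides of a pairing of finite-dimensional spaces have the same rank. -/
theorem LinearMap.finrank_quotient_ker_flip {V W : Type*} [AddCommGroup V] [Module k V]
    [AddCommGroup W] [Module k W] [Module.Finite k V] [Module.Finite k W]
    (B : V →ₗ[k] W →ₗ[k] k) :
    Module.finrank k (V ⧸ LinearMap.ker B) = Module.finrank k (W ⧸ LinearMap.ker B.flip) := by
  rw [B.quotKerEquivRange.finrank_eq, B.flip.quotKerEquivRange.finrank_eq]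
  have h : B.flip = B.dualMap ∘ₗ (Module.evalEquiv k W).toLinearMap := by
    ext w v
    simp
  rw [h, LinearMap.range_comp, LinearEquiv.range, Submodule.map_top]
  exact (LinearMap.finrank_range_dualMap_eq_finrank_range B).symm

/-- For `Z` with local endomorphism ring, the multiplicity of `Z` as a direct summand of `M`. -/
noncomputable def summandMult (k : Type t') [Field k] {C : Type u'} [Category.{v'} C]
    [Preadditive C] [Linear k C] (Z M : C) : ℕ :=
  Module.finrank k ((Z ⟶ M) ⧸ catRad k Z M)

/-- Composition followed by a functional on End(Z) with kernel the radical pairs Hom(Z, M) with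
Hom(M, Z). The kernels on both sides are the radicals, so the quotients have equal dimension. -/
theorem summandMult_eq_finrank_swap {Z M : C} (hZ : HasSplitLocalEnd k Z)
    [Module.Finite k (Z ⟶ M)] [Module.Finite k (M ⟶ Z)] :
    summandMult k Z M = Module.finrank k ((M ⟶ Z) ⧸ catRad k M Z) := by
  obtain ⟨l, hl⟩ := hZ.exists_functional
  let B : (Z ⟶ M) →ₗ[k] (M ⟶ Z) →ₗ[k] k := (Linear.comp Z M Z).compr₂ l
  have hB : ∀ f g, B f g = 0 ↔ f ≫ g ∈ catRad k Z Z := fun f g => by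
    rw [← hl]
    rfl
  have h₁ : LinearMap.ker B = catRad k Z M := by
    ext f
    rw [LinearMap.mem_ker, LinearMap.ext_iff]
    exact ⟨fun h => mem_catRad_of_forall_comp fun g => (hB f g).1 (h g),
      fun h g => (hB f g).2 (comp_mem_catRad_right h g)⟩
  have h₂ : LinearMap.ker B.flip = catRad k M Z := by
    ext g
    rw [LinearMap.mem_ker, LinearMap.ext_iff]
    exact ⟨fun h => mem_catRad_of_forall_comp' fun f => (hB f g).1 (h f),
      fun h f => (hB f g).2 (comp_mem_catRad_left h f)⟩
  rw [summandMult, ← h₁, ← h₂]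
  exact B.finrank_quotient_ker_flip

/-- Composition with an isomorphism, as a linear equivalence. -/
def homPostEquiv (k : Type t') [Field k] {C : Type u'} [Category.{v'} C] [Preadditive C]
    [Linear k C] (Z : C) {M M' : C} (e : M ≅ M') : (Z ⟶ M) ≃ₗ[k] (Z ⟶ M') where
  toFun f := f ≫ e.hom
  invFun f := f ≫ e.inv
  left_inv f := by simp
  right_inv f := by simp
  map_add' := by simp
  map_smul' := by simp

/-- Composition with an isomorphism, as a linear equivalence. -/
def homPreEquiv (k : Type t') [Field k] {C : Type u'} [Category.{v'} C] [Preadditive C]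
    [Linear k C] {Z Z' : C} (e : Z ≅ Z') (M : C) : (Z ⟶ M) ≃ₗ[k] (Z' ⟶ M) where
  toFun f := e.inv ≫ f
  invFun f := e.hom ≫ f
  left_inv f := by simp
  right_inv f := by simp
  map_add' := by simp
  map_smul' := by simp

theorem summandMult_congr_right (Z : C) {M M' : C} (e : M ≅ M') :
    summandMult k Z M = summandMult k Z M' := by
  refine (Submodule.Quotient.equiv _ _ (homPostEquiv k Z e) ?_).finrank_eq
  ext f
  constructor
  · rintro ⟨g, hg, rfl⟩
    exact comp_mem_catRad_right hg e.hom
  · intro hf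
    exact ⟨f ≫ e.inv, comp_mem_catRad_right hf e.inv, by simp [homPostEquiv]⟩

theorem summandMult_congr_left {Z Z' : C} (e : Z ≅ Z') (M : C) :
    summandMult k Z M = summandMult k Z' M := by
  refine (Submodule.Quotient.equiv _ _ (homPreEquiv k e M) ?_).finrank_eq
  ext f
  constructor
  · rintro ⟨g, hg, rfl⟩
    exact comp_mem_catRad_left hg e.inv
  · intro hf
    exact ⟨e.hom ≫ f, comp_mem_catRad_left hf e.hom, by simp [homPreEquiv]⟩

theorem summandMult_of_isZero (Z : C) {M : C} (hM : IsZero M) : summandMult k Z M = 0 := by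
  have : Subsingleton (Z ⟶ M) := ⟨fun f g => hM.eq_of_tgt f g⟩
  exact Module.finrank_zero_of_subsingleton

theorem summandMult_of_iso {Z M : C} (hZ : HasSplitLocalEnd k Z) (e : Z ≅ M) :
    summandMult k Z M = 1 := hZ.finrank_quotient_of_iso e

theorem summandMult_of_isEmpty_iso {Z M : C} (hZ : HasSplitLocalEnd k Z)
    (hM : HasSplitLocalEnd k M) (h : IsEmpty (Z ≅ M)) : summandMult k Z M = 0 := by
  have : catRad k Z M = ⊤ := eq_top_iff.2 fun f _ => hZ.mem_catRad_of_isEmpty_iso hM h f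
  rw [summandMult, this]
  exact Module.finrank_zero_of_subsingleton

section Biprod

variable [HasBinaryBiproducts C]

/-- Morphisms to a biproduct, as a linear equivalence. -/
noncomputable def homBiprodEquiv (k : Type t') [Field k] {C : Type u'} [Category.{v'} C]
    [Preadditive C] [Linear k C] [HasBinaryBiproducts C] (Z M M' : C) :
    (Z ⟶ M ⊞ M') ≃ₗ[k] (Z ⟶ M) × (Z ⟶ M') where
  toFun f := (f ≫ biprod.fst, f ≫ biprod.snd)
  invFun f := biprod.lift f.1 f.2
  left_inv f := by ext <;> simp
  right_inv f := by simp
  map_add' := by simp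
  map_smul' := by simp

theorem finrank_hom_biprod (Z M M' : C) [Module.Finite k (Z ⟶ M)] [Module.Finite k (Z ⟶ M')] :
    Module.finrank k (Z ⟶ M ⊞ M') = Module.finrank k (Z ⟶ M) + Module.finrank k (Z ⟶ M') := by
  rw [(homBiprodEquiv k Z M M').finrank_eq, Module.finrank_prod]

theorem summandMult_biprod (Z M M' : C) [Module.Finite k (Z ⟶ M)] [Module.Finite k (Z ⟶ M')] :
    summandMult k Z (M ⊞ M') = summandMult k Z M + summandMult k Z M' := by
  let φ : (Z ⟶ M ⊞ M') →ₗ[k] ((Z ⟶ M) ⧸ catRad k Z M) × ((Z ⟶ M') ⧸ catRad k Z M') :=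
    ((catRad k Z M).mkQ.prodMap (catRad k Z M').mkQ) ∘ₗ (homBiprodEquiv k Z M M').toLinearMap
  have hφ : Function.Surjective φ :=
    (((catRad k Z M).mkQ_surjective).prodMap ((catRad k Z M').mkQ_surjective)).comp
      (homBiprodEquiv k Z M M').surjective
  have hker : LinearMap.ker φ = catRad k Z (M ⊞ M') := by
    ext f
    have : φ f = (Submodule.Quotient.mk (f ≫ biprod.fst), Submodule.Quotient.mk (f ≫ biprod.snd)) :=
      rfl
    rw [LinearMap.mem_ker, this, Prod.mk_eq_zero, Submodule.Quotient.mk_eq_zero,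
      Submodule.Quotient.mk_eq_zero]
    constructor
    · rintro ⟨h₁, h₂⟩
      have : f = (f ≫ biprod.fst) ≫ biprod.inl + (f ≫ biprod.snd) ≫ biprod.inr := by ext <;> simp
      rw [this]
      exact add_mem (comp_mem_catRad_right h₁ _) (comp_mem_catRad_right h₂ _)
    · exact fun h => ⟨comp_mem_catRad_right h _, comp_mem_catRad_right h _⟩
  rw [summandMult, ← hker, (φ.quotKerEquivOfSurjective hφ).finrank_eq, Module.finrank_prod]
  rfl

end Biprod

end RadicalLemmas

/-! ### Auslander-Reiten triangles -/

section AuslanderReiten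

universe t' v' u'

open Pretriangulated

theorem catRad_of_map {k : Type t'} [Field k] {C : Type u'} [Category.{v'} C] [Preadditive C]
    [Linear k C] (F : C ⥤ C) [F.IsEquivalence] [F.Additive] {X Y : C} {f : X ⟶ Y}
    (hf : F.map f ∈ catRad k (F.obj X) (F.obj Y)) : f ∈ catRad k X Y := fun g => by
  have h := hf (F.map g)
  rw [← F.map_id, ← F.map_comp, ← F.map_sub] at h
  exact isIso_of_reflects_iso _ F

variable {k : Type t'} [Field k] {C : Type u'} [Category.{v'} C] [Preadditive C] [Linear k C]

namespace SerreFunctor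

variable (D : SerreFunctor k C)

/-- Every functional on Hom(Y, SX) comes from a morphism X → Y, and functionals separate vectors. -/
theorem eq_of_forall_iso_apply_eq {X Y : C} {h h' : Y ⟶ D.S.obj X}
    (H : ∀ g : X ⟶ Y, D.iso X Y g h = D.iso X Y g h') : h = h' := by
  rw [← sub_eq_zero, ← Module.forall_dual_apply_eq_zero_iff k]
  intro l
  obtain ⟨g, rfl⟩ := (D.iso X Y).surjective l
  rw [map_sub, H, sub_self]

/-- Additivity of `S` is forced by the duality: naturality in the first variable determines `e ≫
D.S.map f` by composition with `f`, which is additive. -/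
theorem map_add {X Y : C} (f g : X ⟶ Y) : D.S.map (f + g) = D.S.map f + D.S.map g := by
  have key : ∀ (e : D.S.obj X ⟶ D.S.obj X), e ≫ D.S.map (f + g) =
      e ≫ D.S.map f + e ≫ D.S.map g := by
    intro e
    refine D.eq_of_forall_iso_apply_eq fun h => ?_
    rw [← D.naturality_left, _root_.map_add, ← D.naturality_left, ← D.naturality_left,
      Preadditive.add_comp, _root_.map_add, LinearMap.add_apply]
  simpa using key (𝟙 _)

theorem map_smul {X Y : C} (c : k) (f : X ⟶ Y) : D.S.map (c • f) = c • D.S.map f := by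
  have key : ∀ (e : D.S.obj X ⟶ D.S.obj X), e ≫ D.S.map (c • f) = c • (e ≫ D.S.map f) := by
    intro e
    refine D.eq_of_forall_iso_apply_eq fun h => ?_
    rw [← D.naturality_left, _root_.map_smul, ← D.naturality_left, Linear.smul_comp,
      _root_.map_smul, LinearMap.smul_apply]
  simpa using key (𝟙 _)

instance : D.S.Additive where
  map_add := D.map_add _ _

instance : D.S.Linear k where
  map_smul f c := D.map_smul c f

/-- The morphism `w` corresponds under the duality to a functional on End(X) with kernel the
radical. Naturality turns composition of `w` with a radical morphism into evaluation of that
functional on radical endomorphisms. -/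
theorem exists_socle {X : C} (hX : HasSplitLocalEnd k X)
    [Module.Finite k (X ⟶ D.S.obj X)] :
    ∃ w : X ⟶ D.S.obj X, w ≠ 0 ∧
      (∀ (Z : C) (f : Z ⟶ X), f ∈ catRad k Z X → f ≫ w = 0) ∧
      ∀ (Z : C) (g : X ⟶ Z), g ∈ catRad k X Z → w ≫ D.S.map g = 0 := by
  obtain ⟨l, hl⟩ := hX.exists_functional
  have hl' : ∀ f, l f = 0 ↔ f ∈ catRad k X X := fun f => by rw [← hl]; rfl
  let w := (Module.evalEquiv k (X ⟶ D.S.obj X)).symm (l ∘ₗ (D.iso X X).symm.toLinearMap)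
  have hw : ∀ f, D.iso X X f w = l f := by
    intro f
    rw [← Module.Dual.eval_apply k, ← Module.evalEquiv_toLinearMap, LinearEquiv.coe_coe,
      LinearEquiv.apply_symm_apply]
    simp
  refine ⟨w, ?_, ?_, ?_⟩
  · intro h
    have h₁ := hw (𝟙 X)
    rw [h, map_zero, eq_comm, hl'] at h₁
    exact id_notMem_catRad hX.1 h₁
  · intro Z f hf
    refine D.eq_of_forall_iso_apply_eq fun g => ?_
    rw [← D.naturality_right, hw, map_zero, hl']
    exact comp_mem_catRad_left hf g
  · intro Z g hg
    refine D.eq_of_forall_iso_apply_eq fun f => ?_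
    rw [← D.naturality_left, hw, map_zero, hl']
    exact comp_mem_catRad_right hg f

end SerreFunctor

variable [HasZeroObject C] [HasShift C ℤ] [∀ n : ℤ, (shiftFunctor C n).Additive]
  [Pretriangulated C] (D : SerreFunctor k C)

instance : D.tau.Additive := by
  dsimp only [SerreFunctor.tau]
  infer_instance

/-- An Auslander-Reiten triangle `τY ⟶ M ⟶ Y ⟶ τY⟦1⟧`. -/
structure ARTriangle (Y : C) where
  /-- the middle term -/
  M : C
  /-- the left almost split morphism -/
  i : D.tau.obj Y ⟶ M
  /-- the right almost split morphism -/
  p : M ⟶ Y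
  /-- the connecting morphism -/
  w : Y ⟶ (D.tau.obj Y)⟦(1 : ℤ)⟧
  dist : Triangle.mk i p w ∈ distTriang C
  w_ne_zero : w ≠ 0
  comp_w (Z : C) (f : Z ⟶ Y) : f ∈ catRad k Z Y → f ≫ w = 0
  w_comp (Z : C) (g : D.tau.obj Y ⟶ Z) : g ∈ catRad k (D.tau.obj Y) Z → w ≫ g⟦(1 : ℤ)⟧' = 0

theorem nonempty_ARTriangle {Y : C} (hY : HasSplitLocalEnd k Y)
    [Module.Finite k (Y ⟶ D.S.obj Y)] : Nonempty (ARTriangle D Y) := by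
  obtain ⟨w, hw, hw₁, hw₂⟩ := D.exists_socle hY
  let φ := shiftFunctorCompIsoId C (-1 : ℤ) 1 (by simp)
  let w' : Y ⟶ (D.tau.obj Y)⟦(1 : ℤ)⟧ := w ≫ φ.inv.app (D.S.obj Y)
  obtain ⟨M, i, p, h⟩ := distinguished_cocone_triangle₂ w'
  refine ⟨⟨M, i, p, w', h, ?_, ?_, ?_⟩⟩
  · intro h₀
    apply hw
    rw [← cancel_mono (φ.inv.app (D.S.obj Y)), zero_comp]
    exact h₀
  · intro Z f hf
    change f ≫ w ≫ φ.inv.app (D.S.obj Y) = 0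
    rw [← Category.assoc, hw₁ Z f hf, zero_comp]
  · intro Z g hg
    -- The socle property concerns morphisms out of `Y`; since `τ` is an equivalence, a radical
    -- morphism out of `τY` is the image of such a morphism up to isomorphism.
    let e := D.tau.objObjPreimageIso Z
    let g' : Y ⟶ D.tau.objPreimage Z := D.tau.preimage (g ≫ e.inv)
    have hg' : g' ∈ catRad k _ _ := by
      apply catRad_of_map D.tau
      rw [D.tau.map_preimage]
      exact comp_mem_catRad_right hg _
    have hg₁ : g = D.tau.map g' ≫ e.hom := by simp [g']
    have h₁ : w' ≫ (D.tau.map g')⟦(1 : ℤ)⟧' = 0 := by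
      have := φ.inv.naturality (D.S.map g')
      dsimp at this
      change (w ≫ φ.inv.app (D.S.obj Y)) ≫ (shiftFunctor C (1 : ℤ)).map
        ((shiftFunctor C (-1 : ℤ)).map (D.S.map g')) = 0
      rw [Category.assoc, ← this, ← Category.assoc, hw₂ _ _ hg', zero_comp]
    rw [hg₁, Functor.map_comp, ← Category.assoc, h₁, zero_comp]

namespace ARTriangle

variable {D} {Y : C} (T : ARTriangle D Y)

theorem p_comp_w : T.p ≫ T.w = 0 := comp_distTriang_mor_zero₂₃ _ T.dist

theorem i_comp_p : T.i ≫ T.p = 0 := comp_distTriang_mor_zero₁₂ _ T.dist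

theorem w_comp_i : T.w ≫ T.i⟦(1 : ℤ)⟧' = 0 := comp_distTriang_mor_zero₃₁ _ T.dist

/-- Otherwise some `g ≫ T.p` would be invertible, and `T.p ≫ T.w = 0` would give `T.w = 0`. -/
theorem p_mem (hY : HasSplitLocalEnd k Y) : T.p ∈ catRad k T.M Y := by
  refine mem_catRad_of_forall_comp' fun g => ?_
  by_contra h
  have := hY.isIso_of_notMem h
  apply T.w_ne_zero
  rw [← cancel_epi (g ≫ T.p), Category.assoc, T.p_comp_w, comp_zero, comp_zero]

theorem i_mem (hY : HasSplitLocalEnd k (D.tau.obj Y)) : T.i ∈ catRad k (D.tau.obj Y) T.M := by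
  refine mem_catRad_of_forall_comp fun g => ?_
  by_contra h
  have := hY.isIso_of_notMem h
  apply T.w_ne_zero
  rw [← cancel_mono ((T.i ≫ g)⟦(1 : ℤ)⟧'), Functor.map_comp, ← Category.assoc, T.w_comp_i,
    zero_comp, zero_comp]

theorem exists_lift {Z : C} {f : Z ⟶ Y} (hf : f ∈ catRad k Z Y) : ∃ f' : Z ⟶ T.M, f' ≫ T.p = f := by
  obtain ⟨f', h⟩ := Triangle.coyoneda_exact₃ _ T.dist f (T.comp_w Z f hf)
  exact ⟨f', h.symm⟩

theorem exists_desc {Z : C} {g : D.tau.obj Y ⟶ Z} (hg : g ∈ catRad k (D.tau.obj Y) Z) :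
    ∃ g' : T.M ⟶ Z, T.i ≫ g' = g := by
  obtain ⟨g', h⟩ := Triangle.yoneda_exact₃ _ (rot_of_distTriang _ T.dist) (g⟦(1 : ℤ)⟧')
    (T.w_comp Z g hg)
  obtain ⟨g'' : T.M ⟶ Z, rfl⟩ := (shiftFunctor C (1 : ℤ)).map_surjective g'
  have h' : g⟦(1 : ℤ)⟧' = (-T.i⟦(1 : ℤ)⟧') ≫ g''⟦(1 : ℤ)⟧' := h
  refine ⟨-g'', (shiftFunctor C (1 : ℤ)).map_injective ?_⟩
  rw [h']
  simp

theorem exists_of_comp_p {Z : C} {h : Z ⟶ T.M} (hh : h ≫ T.p = 0) : ∃ h', h' ≫ T.i = h := by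
  obtain ⟨h', e⟩ := Triangle.coyoneda_exact₂ _ T.dist h hh
  exact ⟨h', e.symm⟩

theorem exists_of_i_comp {Z : C} {h : T.M ⟶ Z} (hh : T.i ≫ h = 0) : ∃ h', T.p ≫ h' = h := by
  obtain ⟨h', e⟩ := Triangle.yoneda_exact₂ _ T.dist h hh
  exact ⟨h', e.symm⟩

/-- The irreducible morphisms to `Y` are counted by the middle term of the Auslander-Reiten
triangle ending in `Y`. -/
theorem finrank_irr_right (hY : HasSplitLocalEnd k Y) (hτY : HasSplitLocalEnd k (D.tau.obj Y))
    (Z : C) : Module.finrank k (Irr k Z Y) = summandMult k Z T.M := by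
  -- Composition with `p` maps Hom(Z, M) onto rad(Z, Y). The preimage of rad² is rad(Z, M): radical
  -- morphisms to `Y` lift through `p`, and the kernel consists of morphisms through the radical
  -- morphism `i`.
  let φ : (Z ⟶ T.M) →ₗ[k] Irr k Z Y :=
    ((catRadSq k Z Y).submoduleOf (catRad k Z Y)).mkQ ∘ₗ
      (Linear.rightComp k Z T.p).codRestrict (catRad k Z Y)
        (fun h => comp_mem_catRad_left (T.p_mem hY) h)
  have hφ : Function.Surjective φ := by
    intro x
    obtain ⟨⟨f, hf⟩, rfl⟩ := Submodule.mkQ_surjective _ x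
    obtain ⟨f', rfl⟩ := T.exists_lift hf
    exact ⟨f', rfl⟩
  have hφ₀ : ∀ h, φ h = 0 ↔ h ≫ T.p ∈ catRadSq k Z Y := by
    intro h
    change Submodule.Quotient.mk _ = 0 ↔ _
    rw [Submodule.Quotient.mk_eq_zero]
    rfl
  have hle : catRadSq k Z Y ≤ (catRad k Z T.M).map (Linear.rightComp k Z T.p) := by
    refine Submodule.span_le.2 ?_
    rintro _ ⟨W, f, g, hf, hg, rfl⟩
    obtain ⟨g', rfl⟩ := T.exists_lift hg
    exact ⟨f ≫ g', comp_mem_catRad_right hf g', by simp⟩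
  have hker : LinearMap.ker φ = catRad k Z T.M := by
    ext h
    rw [LinearMap.mem_ker, hφ₀]
    constructor
    · intro hh
      obtain ⟨h', hh', e⟩ := hle hh
      have e' : h' ≫ T.p = h ≫ T.p := e
      obtain ⟨a, ha⟩ := T.exists_of_comp_p (h := h - h') (by simp [e'])
      rw [← sub_add_cancel h h', ← ha]
      exact add_mem (comp_mem_catRad_left (T.i_mem hτY) a) hh'
    · intro hh
      exact Submodule.subset_span ⟨_, h, T.p, hh, T.p_mem hY, rfl⟩
  rw [summandMult, ← hker, (φ.quotKerEquivOfSurjective hφ).finrank_eq]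

/-- The irreducible morphisms from `τY` are counted by the middle term of the Auslander-Reiten
triangle ending in `Y`. -/
theorem finrank_irr_left (hY : HasSplitLocalEnd k Y) (hτY : HasSplitLocalEnd k (D.tau.obj Y))
    (Z : C) : Module.finrank k (Irr k (D.tau.obj Y) Z) =
      Module.finrank k ((T.M ⟶ Z) ⧸ catRad k T.M Z) := by
  let φ : (T.M ⟶ Z) →ₗ[k] Irr k (D.tau.obj Y) Z :=
    ((catRadSq k (D.tau.obj Y) Z).submoduleOf (catRad k (D.tau.obj Y) Z)).mkQ ∘ₗ
      (Linear.leftComp k Z T.i).codRestrict (catRad k (D.tau.obj Y) Z)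
        (fun h => comp_mem_catRad_right (T.i_mem hτY) h)
  have hφ : Function.Surjective φ := by
    intro x
    obtain ⟨⟨f, hf⟩, rfl⟩ := Submodule.mkQ_surjective _ x
    obtain ⟨f', rfl⟩ := T.exists_desc hf
    exact ⟨f', rfl⟩
  have hφ₀ : ∀ h, φ h = 0 ↔ T.i ≫ h ∈ catRadSq k (D.tau.obj Y) Z := by
    intro h
    change Submodule.Quotient.mk _ = 0 ↔ _
    rw [Submodule.Quotient.mk_eq_zero]
    rfl
  have hle : catRadSq k (D.tau.obj Y) Z ≤ (catRad k T.M Z).map (Linear.leftComp k Z T.i) := by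
    refine Submodule.span_le.2 ?_
    rintro _ ⟨W, f, g, hf, hg, rfl⟩
    obtain ⟨f', rfl⟩ := T.exists_desc hf
    exact ⟨f' ≫ g, comp_mem_catRad_left hg f', by simp⟩
  have hker : LinearMap.ker φ = catRad k T.M Z := by
    ext h
    rw [LinearMap.mem_ker, hφ₀]
    constructor
    · intro hh
      obtain ⟨h', hh', e⟩ := hle hh
      have e' : T.i ≫ h' = T.i ≫ h := e
      obtain ⟨a, ha⟩ := T.exists_of_i_comp (h := h - h') (by simp [e'])
      rw [← sub_add_cancel h h', ← ha]
      exact add_mem (comp_mem_catRad_right (T.p_mem hY) a) hh'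
    · intro hh
      exact Submodule.subset_span ⟨_, T.i, h, T.i_mem hτY, hh, rfl⟩
  rw [← hker, (φ.quotKerEquivOfSurjective hφ).finrank_eq]

/-- Dimensions along an Auslander-Reiten triangle. -/
theorem finrank_hom_middle (hY : HasSplitLocalEnd k Y) {X : C}
    (h₀ : ∀ f : X ⟶ Y⟦(-1 : ℤ)⟧, f = 0) [Module.Finite k (X ⟶ T.M)] :
    Module.finrank k (X ⟶ T.M) =
      Module.finrank k (X ⟶ D.tau.obj Y) + Module.finrank k (catRad k X Y) := by
  have h₁ := (Linear.rightComp k X T.p).finrank_range_add_finrank_ker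
  have hrange : LinearMap.range (Linear.rightComp k X T.p) = catRad k X Y := by
    ext f
    constructor
    · rintro ⟨g, rfl⟩
      exact comp_mem_catRad_left (T.p_mem hY) g
    · intro hf
      obtain ⟨g, hg⟩ := T.exists_lift hf
      exact ⟨g, hg⟩
  have hker : LinearMap.ker (Linear.rightComp k X T.p) =
      LinearMap.range (Linear.rightComp k X T.i) := by
    ext f
    constructor
    · intro hf
      obtain ⟨g, hg⟩ := T.exists_of_comp_p (h := f) hf
      exact ⟨g, hg⟩
    · rintro ⟨g, rfl⟩
      simp [T.i_comp_p]
  -- The kernel of composition with `i` comes from Hom(X, Y[-1]); the degree hypothesis `h₀` enters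
  -- only here.
  have hinj : Function.Injective (Linear.rightComp k X T.i) := by
    refine (injective_iff_map_eq_zero _).2 fun f hf => ?_
    obtain ⟨g, hg⟩ := Triangle.coyoneda_exact₂ _ (inv_rot_of_distTriang _ T.dist) f hf
    exact hg.trans ((congrArg (· ≫ _) (h₀ g)).trans zero_comp)
  rw [hrange, hker, LinearMap.finrank_range_of_inj hinj] at h₁
  omega

end ARTriangle

end AuslanderReiten

/-! ### Krull-Schmidt decompositions -/

section KrullSchmidt

universe t' v' u'

theorem CategoryTheory.Indecomposable.of_iso {C : Type u'} [Category.{v'} C] [Preadditive C]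
    [HasBinaryBiproducts C] {X Y : C} (hX : Indecomposable X) (e : X ≅ Y) : Indecomposable Y :=
  ⟨fun h => hX.1 (h.of_iso e), fun A B i => hX.2 A B (e ≪≫ i)⟩

variable {k : Type t'} [Field k] {C : Type u'} [Category.{v'} C] [Preadditive C] [Linear k C]

/-- This is the source of the defect term in the additivity relation: modulo the radical only
isomorphisms survive, and they span a line. -/
theorem HasSplitLocalEnd.finrank_hom {X Y : C} (hX : HasSplitLocalEnd k X)
    (hY : HasSplitLocalEnd k Y) [Module.Finite k (X ⟶ Y)] [Decidable (Nonempty (X ≅ Y))] :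
    Module.finrank k (X ⟶ Y) =
      Module.finrank k (catRad k X Y) + if Nonempty (X ≅ Y) then 1 else 0 := by
  rw [← Submodule.finrank_quotient_add_finrank (catRad k X Y), add_comm]
  congr 1
  split_ifs with h
  · exact hX.finrank_quotient_of_iso h.some
  · exact summandMult_of_isEmpty_iso hX hY (not_nonempty_iff.1 h)

variable [HasBinaryBiproducts C]

variable (k) in
/-- Induction along decompositions into indecomposable objects. -/
theorem induction_on_decomposition (hfin : ∀ X Y : C, Module.Finite k (X ⟶ Y)) {P : C → Prop}
    (zero : ∀ X, IsZero X → P X) (indec : ∀ X, Indecomposable X → P X)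
    (biprod : ∀ X Y, P X → P Y → P (X ⊞ Y)) (iso : ∀ {X Y : C}, (X ≅ Y) → P X → P Y) (M : C) :
    P M := by
  -- The dimension of the endomorphism algebra drops for proper summands, since End(X) × End(Y)
  -- embeds into End(X ⊞ Y).
  suffices ∀ (n : ℕ) (M : C), Module.finrank k (M ⟶ M) ≤ n → P M from this _ M le_rfl
  have pos : ∀ X : C, ¬ IsZero X → 0 < Module.finrank k (X ⟶ X) := by
    intro X hX
    have : Nontrivial (X ⟶ X) := ⟨𝟙 X, 0, fun h => hX ((IsZero.iff_id_eq_zero X).2 h)⟩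
    exact Module.finrank_pos
  intro n
  induction n with
  | zero =>
    intro M hM
    by_cases h : IsZero M
    · exact zero M h
    · have := pos M h
      omega
  | succ n ih =>
    intro M hM
    by_cases h : IsZero M
    · exact zero M h
    by_cases h' : Indecomposable M
    · exact indec M h'
    obtain ⟨X, Y, e, hX, hY⟩ : ∃ (X Y : C) (_ : M ≅ X ⊞ Y), ¬ IsZero X ∧ ¬ IsZero Y := by
      by_contra! hcon
      exact h' ⟨h, fun X Y e => or_iff_not_imp_left.2 fun hX => hcon X Y e hX⟩
    have h₁ := pos X hX
    have h₂ := pos Y hY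
    have h₃ : Module.finrank k (X ⟶ X) + Module.finrank k (Y ⟶ Y) ≤ Module.finrank k (M ⟶ M) := by
      rw [← Module.finrank_prod]
      let φ : (X ⟶ X) × (Y ⟶ Y) →ₗ[k] (M ⟶ M) :=
        { toFun := fun f => e.hom ≫ Limits.biprod.map f.1 f.2 ≫ e.inv
          map_add' := fun f g => by
            have : Limits.biprod.map (f + g).1 (f + g).2 =
                Limits.biprod.map f.1 f.2 + Limits.biprod.map g.1 g.2 := by ext <;> simp
            rw [this]
            simp
          map_smul' := fun c f => by
            have : Limits.biprod.map (c • f).1 (c • f).2 = c • Limits.biprod.map f.1 f.2 := by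
              ext <;> simp
            rw [this]
            simp }
      refine LinearMap.finrank_le_finrank_of_injective (f := φ) ?_
      rintro ⟨f, g⟩ ⟨f', g'⟩ h
      have h₁ : Limits.biprod.map f g = Limits.biprod.map f' g' := by
        have h₂ : e.hom ≫ Limits.biprod.map f g ≫ e.inv =
          e.hom ≫ Limits.biprod.map f' g' ≫ e.inv := h
        simpa using h₂
      refine Prod.ext ?_ ?_
      · simpa using Limits.biprod.inl ≫= h₁ =≫ Limits.biprod.fst
      · simpa using Limits.biprod.inr ≫= h₁ =≫ Limits.biprod.snd
    exact iso e.symm (biprod X Y (ih X (by omega)) (ih Y (by omega)))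

namespace ARQuiver

theorem indecomposable_rep (x : ARQuiver k C) : Indecomposable x.rep := (Quotient.out x).2

theorem mk_eq_mk_iff {X Y : C} {hX : Indecomposable X} {hY : Indecomposable Y} :
    mk k X hX = mk k Y hY ↔ Nonempty (X ≅ Y) :=
  Quotient.eq (r := indecSetoid C)

theorem mk_rep (x : ARQuiver k C) : mk k x.rep x.indecomposable_rep = x := Quotient.out_eq x

theorem nonempty_rep_mk_iso (X : C) (hX : Indecomposable X) : Nonempty ((mk k X hX).rep ≅ X) := by
  rw [← mk_eq_mk_iff (k := k) (hX := indecomposable_rep _) (hY := hX), mk_rep]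

theorem eq_iff_nonempty_iso {x y : ARQuiver k C} : x = y ↔ Nonempty (x.rep ≅ y.rep) := by
  rw [← mk_eq_mk_iff (k := k) (hX := x.indecomposable_rep) (hY := y.indecomposable_rep), mk_rep,
    mk_rep]

end ARQuiver

/-- Every object is determined by the multiplicities of its indecomposable summands, as far as
dimensions of spaces of morphisms are concerned. -/
theorem exists_multiplicities (hfin : ∀ X Y : C, Module.Finite k (X ⟶ Y))
    (hloc : ∀ X : C, Indecomposable X → HasSplitLocalEnd k X) (M : C) :
    ∃ s : ARQuiver k C →₀ ℕ, (∀ x, s x = summandMult k x.rep M) ∧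
      ∀ X : C, Module.finrank k (X ⟶ M) = s.sum fun x n => n * Module.finrank k (X ⟶ x.rep) := by
  classical
  induction M using induction_on_decomposition k hfin with
  | zero M hM =>
    refine ⟨0, fun x => (summandMult_of_isZero _ hM).symm, fun X => ?_⟩
    have : Subsingleton (X ⟶ M) := ⟨fun f g => hM.eq_of_tgt f g⟩
    simpa using Module.finrank_zero_of_subsingleton
  | indec M hM =>
    refine ⟨Finsupp.single (ARQuiver.mk k M hM) 1, fun x => ?_, fun X => ?_⟩
    · rw [Finsupp.single_apply]
      by_cases h : ARQuiver.mk k M hM = x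
      · subst h
        obtain ⟨e⟩ := ARQuiver.nonempty_rep_mk_iso (k := k) M hM
        rw [if_pos rfl, summandMult_of_iso (hloc _ (ARQuiver.indecomposable_rep _)) e]
      · rw [if_neg h, summandMult_of_isEmpty_iso (hloc _ x.indecomposable_rep) (hloc _ hM)]
        refine ⟨fun e => h ?_⟩
        rw [← x.mk_rep, ARQuiver.mk_eq_mk_iff]
        exact ⟨e.symm⟩
    · obtain ⟨e⟩ := ARQuiver.nonempty_rep_mk_iso (k := k) M hM
      rw [Finsupp.sum_single_index (by simp), one_mul, (homPostEquiv k X e).finrank_eq]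
  | biprod M M' h h' =>
    obtain ⟨s, hs, hs'⟩ := h
    obtain ⟨t, ht, ht'⟩ := h'
    refine ⟨s + t, fun x => ?_, fun X => ?_⟩
    · rw [summandMult_biprod, Finsupp.add_apply, hs, ht]
    · rw [finrank_hom_biprod, hs', ht', Finsupp.sum_add_index' (by simp) (by intros; ring)]
  | iso e h =>
    obtain ⟨s, hs, hs'⟩ := h
    exact ⟨s, fun x => by rw [hs, summandMult_congr_right _ e], fun X => by
      rw [← (homPostEquiv k X e).finrank_eq, hs']⟩

end KrullSchmidt

/-! ### The Auslander-Reiten quiver as a translation quiver -/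

section Translation

universe t' v' u'

variable {k : Type t'} [Field k] {C : Type u'} [Category.{v'} C] [Preadditive C] [Linear k C]
  [HasZeroObject C] [HasShift C ℤ] [∀ n : ℤ, (shiftFunctor C n).Additive] [Pretriangulated C]
  (D : SerreFunctor k C)

namespace ARQuiver

theorem nonempty_rep_tau_iso (x : ARQuiver k C) :
    Nonempty ((x.tau D).rep ≅ D.tau.obj x.rep) :=
  nonempty_rep_mk_iso _ _

theorem tau_mk (X : C) (hX : Indecomposable X) :
    (mk k X hX).tau D = mk k (D.tau.obj X) (indecomposable_obj_of_isEquivalence D.tau hX) := by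
  obtain ⟨e⟩ := nonempty_rep_mk_iso (k := k) X hX
  exact mk_eq_mk_iff.2 ⟨D.tau.mapIso e⟩

theorem tau_bijective : Function.Bijective (tau D : ARQuiver k C → ARQuiver k C) := by
  constructor
  · intro x y h
    obtain ⟨e⟩ := mk_eq_mk_iff.1 h
    exact eq_iff_nonempty_iso.2 ⟨D.tau.preimageIso e⟩
  · intro y
    have e := D.tau.objObjPreimageIso y.rep
    have h : Indecomposable (D.tau.objPreimage y.rep) :=
      (indecomposable_obj_of_isEquivalence D.tau.inv
        (y.indecomposable_rep.of_iso e.symm)).of_iso (D.tau.asEquivalence.unitIso.app _).symm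
    refine ⟨mk k _ h, ?_⟩
    rw [tau_mk]
    exact (mk_eq_mk_iff.2 ⟨e⟩).trans y.mk_rep

/-- The translation as a permutation of the vertices. -/
noncomputable def tauPerm : Equiv.Perm (ARQuiver k C) := Equiv.ofBijective _ (tau_bijective D)

/-- The arrows of the Auslander-Reiten quiver: local finiteness, the translation property, and
additivity of dimensions of spaces of morphisms. -/
theorem exists_arrows (hfin : ∀ X Y : C, Module.Finite k (X ⟶ Y))
    (hloc : ∀ X : C, Indecomposable X → HasSplitLocalEnd k X) [DecidableEq (ARQuiver k C)] :
    ∃ N : ARQuiver k C → ARQuiver k C →₀ ℕ,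
      (∀ y z, N y z = Module.finrank k (Irr k z.rep y.rep)) ∧
      (∀ y z, N y z = N z (y.tau D)) ∧
      (∀ y (T : ARTriangle D y.rep) z, N y z = summandMult k z.rep T.M) ∧
      ∀ x y : ARQuiver k C, (∀ f : x.rep ⟶ y.rep⟦(-1 : ℤ)⟧, f = 0) →
        Module.finrank k (x.rep ⟶ (y.tau D).rep) + Module.finrank k (x.rep ⟶ y.rep) =
          ((N y).sum fun z n => n * Module.finrank k (x.rep ⟶ z.rep)) +
            if x = y then 1 else 0 := by
  classical
  have hl : ∀ x : ARQuiver k C, HasSplitLocalEnd k x.rep := fun x => hloc _ x.indecomposable_rep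
  have hlτ : ∀ x : ARQuiver k C, HasSplitLocalEnd k (D.tau.obj x.rep) := fun x =>
    hloc _ (indecomposable_obj_of_isEquivalence D.tau x.indecomposable_rep)
  have T : ∀ y : ARQuiver k C, ARTriangle D y.rep := fun y => (nonempty_ARTriangle D (hl y)).some
  choose N hN hN' using fun y : ARQuiver k C => exists_multiplicities hfin hloc (T y).M
  have h₁ : ∀ y z, N y z = Module.finrank k (Irr k z.rep y.rep) := fun y z => by
    rw [hN, (T y).finrank_irr_right (hl y) (hlτ y)]
  refine ⟨N, h₁, fun y z => ?_, fun y T' z => ?_, fun x y h₀ => ?_⟩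
  -- Both sides are the multiplicity of `z` in the middle term of the triangle ending in `y`, read
  -- off from morphisms into that term on the left and out of it on the right.
  · obtain ⟨e⟩ := nonempty_rep_tau_iso D y
    rw [hN, hN, summandMult_congr_left e, ← (T z).finrank_irr_right (hl z) (hlτ z),
      (T y).finrank_irr_left (hl y) (hlτ y), summandMult_eq_finrank_swap (hl z)]
  · rw [h₁, T'.finrank_irr_right (hl y) (hlτ y)]
  · obtain ⟨e⟩ := nonempty_rep_tau_iso D y
    have h₂ := (T y).finrank_hom_middle (hl y) h₀
    rw [hN'] at h₂
    rw [h₂, (hl x).finrank_hom (hl y), (homPostEquiv k x.rep e).finrank_eq, ← add_assoc]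
    simp only [eq_iff_nonempty_iso]

end ARQuiver

end Translation

/-! ### Periodic components -/

section Periodic

universe t' v' u'

/-- An injective self-map of a finite set has only periodic points. -/
theorem exists_iterate_eq_self_of_finite {α : Type*} {s : Set α} (hs : s.Finite) {f : α → α}
    (hf : Function.Injective f) (hmaps : Set.MapsTo f s s) {x : α} (hx : x ∈ s) :
    ∃ n, 1 ≤ n ∧ f^[n] x = x := by
  have := hs.to_subtype
  obtain ⟨a, b, hab, h⟩ := Finite.exists_ne_map_eq_of_infinite
    (fun n : ℕ => (⟨f^[n] x, hmaps.iterate n hx⟩ : s))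
  have h' : f^[a] x = f^[b] x := congrArg Subtype.val h
  wlog hlt : a < b generalizing a b
  · exact this b a hab.symm h.symm h'.symm (by omega)
  refine ⟨b - a, by omega, (hf.iterate a) ?_⟩
  rw [← Function.iterate_add_apply, Nat.add_sub_cancel' hlt.le, h']

variable {k : Type t'} [Field k] {C : Type u'} [Category.{v'} C] [Preadditive C] [Linear k C]
  [HasZeroObject C] [HasShift C ℤ] [∀ n : ℤ, (shiftFunctor C n).Additive] [Pretriangulated C]

/-- A nonzero object receives only zero morphisms from a class of indecomposable objects if these
are finitely many, and all morphisms factor over radical ones inside the class. -/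
theorem eq_zero_of_forall_exists_radical_factorization
    (hfin : ∀ X Y : C, Module.Finite k (X ⟶ Y))
    (hloc : ∀ X : C, Indecomposable X → HasSplitLocalEnd k X)
    {S : Set (ARQuiver k C)} (hS : S.Finite) {Z : C}
    (hfac : ∀ y ∈ S, ∀ f : y.rep ⟶ Z, ∃ (M : C) (i : y.rep ⟶ M) (g : M ⟶ Z), i ≫ g = f ∧
      i ∈ catRad k y.rep M ∧ ∀ z : ARQuiver k C, summandMult k z.rep M ≠ 0 → z ∈ S)
    {y : ARQuiver k C} (hy : y ∈ S) (f : y.rep ⟶ Z) : f = 0 := by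
  classical
  have := hS.fintype
  -- The sum of all basis morphisms from objects of `S` is a map `g : ⨁ F ⟶ Z` through which every
  -- morphism from an object with summands in `S` factors. The radical factorizations give `g = σ ≫
  -- g` with `σ` a radical endomorphism, so `𝟙 - σ` is invertible and `g = 0`.
  let J : Type _ := Σ y : S, Fin (Module.finrank k (y.1.rep ⟶ Z))
  let b : ∀ y : S, Module.Basis (Fin (Module.finrank k (y.1.rep ⟶ Z))) k (y.1.rep ⟶ Z) :=
    fun y => Module.finBasis k _
  let F : J → C := fun j => j.1.1.rep
  let g : (⨁ F) ⟶ Z := biproduct.desc fun j => b j.1 j.2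
  have hg : ∀ y ∈ S, ∀ f : y.rep ⟶ Z, ∃ s : y.rep ⟶ ⨁ F, s ≫ g = f := by
    intro y hy f
    refine ⟨∑ i, (b ⟨y, hy⟩).repr f i • biproduct.ι F ⟨⟨y, hy⟩, i⟩, ?_⟩
    rw [Preadditive.sum_comp]
    conv_rhs => rw [← (b ⟨y, hy⟩).sum_repr f]
    refine Finset.sum_congr rfl fun i _ => ?_
    rw [Linear.smul_comp]
    simp [g]
  have hM : ∀ M : C, (∀ z : ARQuiver k C, summandMult k z.rep M ≠ 0 → z ∈ S) →
      ∀ f : M ⟶ Z, ∃ s : M ⟶ ⨁ F, s ≫ g = f := by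
    intro M
    induction M using induction_on_decomposition k hfin with
    | zero M hM => exact fun _ f => ⟨0, hM.eq_of_src _ _⟩
    | indec M hM =>
      intro h f
      obtain ⟨e⟩ := ARQuiver.nonempty_rep_mk_iso (k := k) M hM
      obtain ⟨s, hs⟩ := hg _ (h (ARQuiver.mk k M hM) (by
        rw [summandMult_of_iso (hloc _ (ARQuiver.indecomposable_rep _)) e]
        exact one_ne_zero)) (e.hom ≫ f)
      exact ⟨e.inv ≫ s, by simp [hs]⟩
    | biprod M M' h h' =>
      intro hMM f
      obtain ⟨s, hs⟩ := h (fun z hz => hMM z (by rw [summandMult_biprod]; omega)) (biprod.inl ≫ f)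
      obtain ⟨s', hs'⟩ := h' (fun z hz => hMM z (by rw [summandMult_biprod]; omega))
        (biprod.inr ≫ f)
      refine ⟨biprod.desc s s', ?_⟩
      ext <;> simp [hs, hs']
    | iso e h =>
      intro hM f
      obtain ⟨s, hs⟩ := h (fun z hz => hM z (by rwa [← summandMult_congr_right _ e])) (e.hom ≫ f)
      exact ⟨e.inv ≫ s, by simp [hs]⟩
  have hσ : ∀ j : J, ∃ σ : F j ⟶ ⨁ F, σ ∈ catRad k (F j) (⨁ F) ∧ σ ≫ g = b j.1 j.2 := by
    intro j
    obtain ⟨M, i, h, hi, hrad, hsum⟩ := hfac j.1.1 j.1.2 (b j.1 j.2)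
    obtain ⟨s, rfl⟩ := hM M hsum h
    exact ⟨i ≫ s, comp_mem_catRad_right hrad s, by rw [Category.assoc, hi]⟩
  choose σ hσ hσg using hσ
  have hrad : biproduct.desc σ ∈ catRad k (⨁ F) (⨁ F) := by
    have hsum : biproduct.desc σ = ∑ j, biproduct.π F j ≫ σ j := by
      refine biproduct.hom_ext' _ _ fun j => ?_
      rw [biproduct.ι_desc, Preadditive.comp_sum, Finset.sum_eq_single j]
      · simp
      · intro i _ hij
        rw [biproduct.ι_π_ne_assoc _ hij.symm, zero_comp]
      · simp
    rw [hsum]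
    exact Submodule.sum_mem _ fun j _ => comp_mem_catRad_left (hσ j) _
  have hfix : biproduct.desc σ ≫ g = g := by
    refine biproduct.hom_ext' _ _ fun j => ?_
    simp [g, hσg]
  have hiso : IsIso (𝟙 (⨁ F) - biproduct.desc σ) := by simpa using hrad (𝟙 _)
  have hg0 : g = 0 := by
    rw [← cancel_epi (𝟙 (⨁ F) - biproduct.desc σ), Preadditive.sub_comp, hfix]
    simp
  obtain ⟨s, rfl⟩ := hg y hy f
  rw [hg0, comp_zero]

variable (D : SerreFunctor k C)

/-- A component of the Auslander-Reiten quiver that contains a periodic vertex is a tube, if the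
category has a degree function as in the hereditary case. -/
theorem isTube_of_periodic [∀ n : ℤ, (shiftFunctor C n).Linear k]
    (hfin : ∀ X Y : C, Module.Finite k (X ⟶ Y))
    (hloc : ∀ X : C, Indecomposable X → HasSplitLocalEnd k X)
    (deg : C → ℤ)
    (hdeg : ∀ X Y : C, Indecomposable X → Indecomposable Y → ∀ f : X ⟶ Y, f ≠ 0 →
      deg X ≤ deg Y ∧ deg Y ≤ deg X + 1)
    (hshift : ∀ (X : C) (n : ℤ), Indecomposable X → deg (X⟦n⟧) = deg X + n)
    {x₀ : ARQuiver k C} {r : ℕ} (hr : 1 ≤ r) (hx₀ : (ARQuiver.tau D)^[r] x₀ = x₀) :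
    IsTube D (Quiver.WeaklyConnectedComponent.mk x₀) := by
  classical
  obtain ⟨N, hN, hNτ, hNT, hNadd⟩ := ARQuiver.exists_arrows D hfin hloc
  let τ := ARQuiver.tauPerm D
  change τ^[r] x₀ = x₀ at hx₀
  have hNτ' : ∀ y z, N y z = N z (τ y) := hNτ
  have hNττ : ∀ y z, N (τ y) (τ z) = N y z := fun y z => by rw [hNτ' y z, hNτ' z (τ y)]
  have hNit : ∀ n y z, N (τ^[n] y) (τ^[n] z) = N y z := by
    intro n
    induction n with
    | zero => simp
    | succ n ih => intro y z; rw [Function.iterate_succ_apply', Function.iterate_succ_apply',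
        hNττ, ih]
  have hind : ∀ x : ARQuiver k C, Indecomposable x.rep := ARQuiver.indecomposable_rep
  have hshind : ∀ (n : ℤ) (X : C), Indecomposable X → Indecomposable (X⟦n⟧) := fun n X hX =>
    indecomposable_obj_of_isEquivalence (shiftFunctor C n) hX
  have hτind : ∀ X : C, Indecomposable X → Indecomposable (D.tau.obj X) := fun X hX =>
    indecomposable_obj_of_isEquivalence D.tau hX
  have hdeg_iso : ∀ X Y : C, Indecomposable X → (X ≅ Y) → deg X = deg Y := by
    intro X Y hX e
    have hY := hX.of_iso e
    have h₁ := hdeg X Y hX hY e.hom (fun h => hX.1 ((IsZero.iff_id_eq_zero X).2 (by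
      rw [← e.hom_inv_id, h, zero_comp])))
    have h₂ := hdeg Y X hY hX e.inv (fun h => hX.1 ((IsZero.iff_id_eq_zero X).2 (by
      rw [← e.hom_inv_id, h, comp_zero])))
    omega
  have hT : ∀ y : ARQuiver k C, Nonempty (ARTriangle D y.rep) := fun y =>
    nonempty_ARTriangle D (hloc _ (hind y))
  have hdegτ' : ∀ y : ARQuiver k C, deg (τ y).rep = deg (D.tau.obj y.rep) := by
    intro y
    obtain ⟨e⟩ := ARQuiver.nonempty_rep_tau_iso D y
    exact hdeg_iso _ _ (hind _) e
  -- The nonzero connecting morphism `y ⟶ τy⟦1⟧` raises the degree by at most one.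
  have hdegτ : ∀ y : ARQuiver k C, deg (τ y).rep ≤ deg y.rep := by
    intro y
    obtain ⟨T⟩ := hT y
    have := (hdeg _ _ (hind y) (hshind 1 _ (hτind _ (hind y))) T.w T.w_ne_zero).2
    rw [hshift _ _ (hτind _ (hind y)), ← hdegτ'] at this
    omega
  have hdegit : ∀ n (y : ARQuiver k C), deg (τ^[n] y).rep ≤ deg y.rep := by
    intro n
    induction n with
    | zero => intro y; exact le_rfl
    | succ n ih =>
      intro y
      rw [Function.iterate_succ_apply']
      exact (hdegτ _).trans (ih y)
  have hdegper : ∀ (y : ARQuiver k C) (n : ℕ), 1 ≤ n → τ^[n] y = y →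
      deg (τ y).rep = deg y.rep := by
    intro y n hn hy
    refine le_antisymm (hdegτ y) ?_
    obtain ⟨m, rfl⟩ := Nat.exists_eq_add_of_le' hn
    rw [Function.iterate_succ_apply] at hy
    have := hdegit m (τ y)
    rwa [hy] at this
  have hnz : ∀ y z, N y z ≠ 0 → ∃ f : z.rep ⟶ y.rep, f ≠ 0 := by
    intro y z h
    by_contra! hcon
    apply h
    have : Subsingleton (z.rep ⟶ y.rep) := ⟨fun f g => by rw [hcon f, hcon g]⟩
    rw [hN]
    have : Subsingleton (catRad k z.rep y.rep) := inferInstance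
    exact Module.finrank_zero_of_subsingleton
  let Per : ARQuiver k C → Prop := fun y => ∃ n, 1 ≤ n ∧ τ^[n] y = y
  have per_τ : ∀ y, Per y → Per (τ y) := by
    rintro y ⟨n, hn, hy⟩
    exact ⟨n, hn, by rw [← Function.iterate_succ_apply τ, Function.iterate_succ_apply' τ, hy]⟩
  have per_τ' : ∀ y, Per (τ y) → Per y := by
    rintro y ⟨n, hn, hy⟩
    refine ⟨n, hn, τ.injective ?_⟩
    rw [← Function.iterate_succ_apply' τ, Function.iterate_succ_apply τ, hy]
  -- If `τ^n` fixes `y`, it permutes the finitely many predecessors of `y`.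
  have per_pred : ∀ y z, N y z ≠ 0 → Per y → Per z := by
    rintro y z h ⟨n, hn, hy⟩
    obtain ⟨m, hm, hz⟩ := exists_iterate_eq_self_of_finite (f := τ^[n]) (N y).support.finite_toSet
      (τ.injective.iterate n) (fun w hw => by
        simp only [SetLike.mem_coe, Finsupp.mem_support_iff] at hw ⊢
        rwa [← hNit n, hy] at hw) (by simpa using h)
    exact ⟨n * m, Nat.mul_pos hn hm, by rw [Function.iterate_mul, hz]⟩
  have per_succ : ∀ y z, N y z ≠ 0 → Per z → Per y := by
    intro y z h hz
    rw [hNτ'] at h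
    exact per_τ' _ (per_pred _ _ h hz)
  -- The degree of `z` is squeezed between those of `τy` and `y`, which agree for periodic `y`.
  have deg_arrow : ∀ y z, N y z ≠ 0 → Per y → deg z.rep = deg y.rep := by
    intro y z h hy
    obtain ⟨n, hn, hy'⟩ := hy
    have h₁ := hdegper y n hn hy'
    obtain ⟨f, hf⟩ := hnz _ _ h
    rw [hNτ'] at h
    obtain ⟨g, hg⟩ := hnz _ _ h
    have h₂ := hdeg _ _ (hind _) (hind _) f hf
    have h₃ := hdeg _ _ (hind _) (hind _) g hg
    omega
  have arrow_iff : ∀ y z : ARQuiver k C, Nonempty (z ⟶ y) ↔ N y z ≠ 0 := by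
    intro y z
    rw [hN]
    change Nonempty (Fin _) ↔ _
    rw [← Fin.pos_iff_nonempty, Nat.pos_iff_ne_zero]
  let R : ARQuiver k C → ARQuiver k C → Prop := fun y z => N y z ≠ 0
  set K := Quiver.WeaklyConnectedComponent.mk x₀ with hK
  have mem_of_arrow : ∀ y z : ARQuiver k C, N y z ≠ 0 →
      Quiver.WeaklyConnectedComponent.mk y = Quiver.WeaklyConnectedComponent.mk z := by
    intro y z h
    obtain ⟨f⟩ := (arrow_iff y z).2 h
    exact (Quiver.WeaklyConnectedComponent.eq _ _).2
      ⟨Quiver.Hom.toPath (V := Quiver.Symmetrify (ARQuiver k C)) (a := y) (b := z) (Sum.inr f)⟩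
  let Γ := {x : ARQuiver k C // Quiver.WeaklyConnectedComponent.mk x = K}
  have connΓ : ∀ x y : Γ, Relation.EqvGen (fun u v : Γ => N u.1 v.1 ≠ 0) x y := by
    rintro ⟨x, hx⟩ ⟨y, hy⟩
    obtain ⟨p⟩ := (Quiver.WeaklyConnectedComponent.eq _ _).1 (hx.trans hy.symm)
    have key : ∀ (z : Quiver.Symmetrify (ARQuiver k C))
        (p : @Quiver.Path (Quiver.Symmetrify (ARQuiver k C)) _ x z),
        ∃ hz : Quiver.WeaklyConnectedComponent.mk (V := ARQuiver k C) z = K,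
          Relation.EqvGen (fun u v : Γ => N u.1 v.1 ≠ 0) ⟨x, hx⟩ ⟨z, hz⟩ := by
      intro z p
      induction p with
      | nil => exact ⟨hx, Relation.EqvGen.refl _⟩
      | @cons u w _ f ih =>
        obtain ⟨hu, ih⟩ := ih
        rcases f with f | f
        · have h := (arrow_iff _ _).1 ⟨f⟩
          have hw := (mem_of_arrow _ _ h).trans hu
          exact ⟨hw, ih.trans _ _ _ (Relation.EqvGen.symm _ _ (Relation.EqvGen.rel _ _ h))⟩
        · have h := (arrow_iff _ _).1 ⟨f⟩
          have hw := (mem_of_arrow _ _ h).symm.trans hu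
          exact ⟨hw, ih.trans _ _ _ (Relation.EqvGen.rel _ _ h)⟩
    exact (key y p).2
  have propΓ : ∀ x : Γ, Per x.1 ∧ deg x.1.rep = deg x₀.rep := by
    have key : ∀ x y : Γ, (Per x.1 ∧ deg x.1.rep = deg x₀.rep) ↔
        (Per y.1 ∧ deg y.1.rep = deg x₀.rep) := by
      intro x y
      induction connΓ x y with
      | rel u v h =>
        constructor
        · rintro ⟨h₁, h₂⟩
          exact ⟨per_pred _ _ h h₁, (deg_arrow _ _ h h₁).trans h₂⟩
        · rintro ⟨h₁, h₂⟩
          have h₃ := per_succ _ _ h h₁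
          exact ⟨h₃, (deg_arrow _ _ h h₃).symm.trans h₂⟩
      | refl => rfl
      | symm _ _ _ ih => exact ih.symm
      | trans _ _ _ _ _ ih₁ ih₂ => exact ih₁.trans ih₂
    exact fun x => (key ⟨x₀, rfl⟩ x).1 ⟨⟨r, hr, hx₀⟩, rfl⟩
  have additive : ∀ x y : ARQuiver k C, deg x.rep = deg y.rep →
      Module.finrank k (x.rep ⟶ (y.tau D).rep) + Module.finrank k (x.rep ⟶ y.rep) =
          ((N y).sum fun z n => n * Module.finrank k (x.rep ⟶ z.rep)) +
            if x = y then 1 else 0 := by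
    intro x y hxy
    refine hNadd x y fun f => ?_
    by_contra hf
    have := (hdeg _ _ (hind x) (hshind (-1) _ (hind y)) f hf).1
    rw [hshift _ _ (hind y)] at this
    omega
  have hself : ∀ x : ARQuiver k C, 0 < Module.finrank k (x.rep ⟶ x.rep) := by
    intro x
    have : Nontrivial (x.rep ⟶ x.rep) :=
      ⟨𝟙 _, 0, fun h => (hind x).1 ((IsZero.iff_id_eq_zero _).2 h)⟩
    exact Module.finrank_pos
  have mem_τ : ∀ x : Γ, Quiver.WeaklyConnectedComponent.mk (τ x.1) = K := by
    intro x
    obtain ⟨⟨n, hn, hx⟩, hx'⟩ := propΓ x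
    by_cases h : ∃ z, N x.1 z ≠ 0
    · obtain ⟨z, hz⟩ := h
      have h₁ := mem_of_arrow _ _ hz
      rw [hNτ'] at hz
      rw [← mem_of_arrow _ _ hz, ← h₁]
      exact x.2
    -- Without predecessors, additivity at the pair `τx`, `x` leaves only the defect term against
    -- the positive dimension of End(τx), so `τx = x`.
    · push Not at h
      have h₀ : N x.1 = 0 := Finsupp.ext h
      have h₁ := additive (τ x.1) x.1 (hdegper _ n hn hx)
      rw [h₀, Finsupp.sum_zero_index, zero_add] at h₁
      have h₂ := hself (τ x.1)
      by_cases h₃ : τ x.1 = x.1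
      · rw [h₃]; exact x.2
      · rw [if_neg h₃] at h₁
        change Module.finrank k ((τ x.1).rep ⟶ (τ x.1).rep) + _ = _ at h₁
        omega
  have mem_τ' : ∀ y, Quiver.WeaklyConnectedComponent.mk (τ y) = K →
      Quiver.WeaklyConnectedComponent.mk y = K := by
    intro y hy
    obtain ⟨n, hn, h⟩ := per_τ' _ (propΓ ⟨τ y, hy⟩).1
    have key : ∀ m, Quiver.WeaklyConnectedComponent.mk (τ^[m] (τ y)) = K := by
      intro m
      induction m with
      | zero => exact hy
      | succ m ih => rw [Function.iterate_succ_apply']; exact mem_τ ⟨_, ih⟩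
    obtain ⟨m, rfl⟩ := Nat.exists_eq_add_of_le' hn
    have := key m
    rwa [← Function.iterate_succ_apply τ, h] at this
  let τΓ : Equiv.Perm Γ := τ.subtypePerm fun x => ⟨fun h => mem_τ' x h, fun h => mem_τ ⟨x, h⟩⟩
  let NΓ : Γ → Γ →₀ ℕ := fun y =>
    (N y.1).subtypeDomain fun x => Quiver.WeaklyConnectedComponent.mk x = K
  let h : Γ → Γ → ℕ := fun x y => Module.finrank k (x.1.rep ⟶ y.1.rep)
  -- In a finite component, every morphism from a member `y` to `τx₀⟦1⟧` is radical because the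
  -- degrees differ, hence factors through the left almost split morphism out of `y`, whose target
  -- has its summands in the component. The Nakayama argument then contradicts `w ≠ 0`.
  have hinf : Infinite Γ := by
    by_contra hfinite
    rw [not_infinite_iff_finite] at hfinite
    obtain ⟨T⟩ := hT x₀
    refine T.w_ne_zero (eq_zero_of_forall_exists_radical_factorization (k := k) hfin hloc
      (S := {x | Quiver.WeaklyConnectedComponent.mk x = K}) (Set.finite_coe_iff.1 hfinite) ?_ (y := x₀) rfl T.w)
    intro y hy f
    have hy₁ : Quiver.WeaklyConnectedComponent.mk (τ.symm y) = K := mem_τ' _ (by simpa using hy)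
    obtain ⟨T'⟩ := hT (τ.symm y)
    obtain ⟨e⟩ := ARQuiver.nonempty_rep_tau_iso D (τ.symm y)
    have e' : y.rep ≅ D.tau.obj (τ.symm y).rep :=
      eqToIso (congrArg ARQuiver.rep (τ.apply_symm_apply y).symm) ≪≫ e
    have hZ := hshind 1 _ (hτind _ (hind x₀))
    have hrad : e'.inv ≫ f ∈ catRad k _ _ := by
      refine (hloc _ (hτind _ (hind _))).mem_catRad_of_isEmpty_iso (hloc _ hZ) ⟨fun i => ?_⟩ _
      have h₁ := hdeg_iso _ _ (hind _) (e' ≪≫ i)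
      rw [hshift _ _ (hτind _ (hind x₀)), ← hdegτ', hdegper _ r hr hx₀,
        (propΓ ⟨y, hy⟩).2] at h₁
      omega
    obtain ⟨g, hg⟩ := T'.exists_desc hrad
    refine ⟨T'.M, e'.hom ≫ T'.i, g, by simp [hg], ?_, ?_⟩
    · exact comp_mem_catRad_left (T'.i_mem (hloc _ (hτind _ (hind _)))) _
    · intro z hz
      rw [← hNT] at hz
      exact (mem_of_arrow _ _ hz).symm.trans hy₁
  obtain ⟨s, hs, e, he, heτ⟩ := exists_tube_equiv (τ := τΓ) (N := NΓ) (h := h)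
    (fun y z => hNτ' y.1 z.1) (fun x y => by
      obtain ⟨e₁⟩ := ARQuiver.nonempty_rep_tau_iso D x.1
      obtain ⟨e₂⟩ := ARQuiver.nonempty_rep_tau_iso D y.1
      change Module.finrank k ((x.1.tau D).rep ⟶ (y.1.tau D).rep) = _
      rw [(homPreEquiv k e₁ _).finrank_eq, (homPostEquiv k _ e₂).finrank_eq]
      have : D.tau.Linear k := by
        dsimp only [SerreFunctor.tau]
        infer_instance
      exact (LinearEquiv.ofBijective (D.tau.mapLinearMap k)
        ⟨D.tau.map_injective, D.tau.map_surjective⟩).finrank_eq.symm)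
    (fun x => (hself x.1).ne')
    (fun x y => by
      have h₁ := additive x.1 y.1 ((propΓ x).2.trans (propΓ y).2.symm)
      change Module.finrank k (x.1.rep ⟶ (y.1.tau D).rep) + Module.finrank k (x.1.rep ⟶ y.1.rep) = _
      rw [h₁]
      congr 1
      · exact (Finsupp.sum_subtypeDomain_index (h := fun z n =>
          n * Module.finrank k (x.1.rep ⟶ z.rep)) (fun z hz =>
          (mem_of_arrow _ _ (Finsupp.mem_support_iff.1 hz)).symm.trans y.2)).symm
      · exact if_congr Subtype.ext_iff.symm rfl rfl)
    connΓ
    (fun x => by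
      obtain ⟨n, hn, hx⟩ := (propΓ x).1
      refine Function.IsPeriodicPt.minimalPeriod_pos hn (Subtype.ext ?_)
      have key : ∀ m, (τΓ^[m] x).1 = τ^[m] x.1 := by
        intro m
        induction m with
        | zero => rfl
        | succ m ih => rw [Function.iterate_succ_apply', Function.iterate_succ_apply', ← ih]; rfl
      rw [key, hx])
  refine ⟨s, hs, e, fun x y => ?_, fun x => congrArg Subtype.val (heτ x)⟩
  have h₁ : Module.finrank k (Irr k (e x).1.rep (e y).1.rep) = _ :=
    (hN (e y).1 (e x).1).symm.trans (he x y)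
  change Nonempty (PLift _ ≃ Fin _)
  rw [h₁]
  split_ifs with h₂
  · have : Unique (PLift ((y.1 = x.1 ∧ y.2 = x.2 + 1) ∨ (y.1 = x.1 + 1 ∧ x.2 = y.2 + 1))) :=
      ⟨⟨⟨h₂⟩⟩, fun _ => Subsingleton.elim _ _⟩
    exact ⟨Equiv.ofUnique _ _⟩
  · have : IsEmpty (PLift ((y.1 = x.1 ∧ y.2 = x.2 + 1) ∨ (y.1 = x.1 + 1 ∧ x.2 = y.2 + 1))) :=
      ⟨fun h => h₂ h.down⟩
    exact ⟨Equiv.equivOfIsEmpty _ _⟩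

end Periodic

/-! ### Finite-dimensional algebras without idempotents -/

section Fitting

variable {k R : Type*} [Field k] [Ring R] [Algebra k R]

/-- In a finite-dimensional algebra without nontrivial idempotents, every element is nilpotent or
a unit. -/
theorem isNilpotent_or_isUnit_of_forall_idempotent [Module.Finite k R]
    (hR : ∀ e : R, e * e = e → e = 0 ∨ e = 1) (f : R) : IsNilpotent f ∨ IsUnit f := by
  obtain ⟨a, q, hq, hq'⟩ : ∃ (a : ℕ) (q : Polynomial k), minpoly k f = Polynomial.X ^ a * q ∧
      ¬ Polynomial.X ∣ q := by
    obtain ⟨q, hq, hq'⟩ := Polynomial.exists_eq_pow_rootMultiplicity_mul_and_not_dvd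
      (minpoly k f) (minpoly.ne_zero (Algebra.IsIntegral.isIntegral f)) 0
    rw [map_zero, sub_zero] at hq hq'
    exact ⟨_, q, hq, hq'⟩
  -- The Bézout relation evaluated at `f` gives two complementary idempotents with product zero. The
  -- exponent `a + 1` leaves a factor of `f` in the first even for `a = 0`, so that `f` is a unit
  -- when this idempotent is 1.
  obtain ⟨u, v, huv⟩ : IsCoprime ((Polynomial.X : Polynomial k) ^ (a + 1)) q :=
    ((Polynomial.irreducible_X.coprime_iff_not_dvd).2 hq').pow_left
  have hzero : ∀ p s : Polynomial k, p = s * minpoly k f → Polynomial.aeval f p = 0 :=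
    fun p s h => by rw [h, map_mul, minpoly.aeval, mul_zero]
  have hone : Polynomial.aeval f (u * Polynomial.X ^ (a + 1)) +
      Polynomial.aeval f (v * q) = 1 := by rw [← map_add, huv, map_one]
  have he : Polynomial.aeval f (u * Polynomial.X ^ (a + 1)) * Polynomial.aeval f (v * q) = 0 := by
    rw [← map_mul]
    exact hzero _ (u * v * Polynomial.X) (by rw [hq]; ring)
  rcases hR (Polynomial.aeval f (u * Polynomial.X ^ (a + 1))) (by
    have h := congrArg (Polynomial.aeval f (u * Polynomial.X ^ (a + 1)) * ·) hone
    simpa only [mul_add, he, add_zero, mul_one] using h) with h | h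
  · left
    refine ⟨a, ?_⟩
    rw [h, zero_add] at hone
    have h₁ : Polynomial.aeval f (Polynomial.X ^ a * (v * q)) = 0 :=
      hzero _ v (by rw [hq]; ring)
    simpa [hone, map_mul, ← map_mul (Polynomial.aeval f) v q] using h₁
  · right
    have h₁ : Polynomial.aeval f (u * Polynomial.X ^ a) * f = 1 := by
      have h₃ : Polynomial.aeval f (u * Polynomial.X ^ a * Polynomial.X) = 1 := by
        rw [← h]; congr 1; ring
      rwa [map_mul _ _ Polynomial.X, Polynomial.aeval_X] at h₃
    have h₂ : f * Polynomial.aeval f (u * Polynomial.X ^ a) = 1 := by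
      have h₃ : Polynomial.aeval f (Polynomial.X * (u * Polynomial.X ^ a)) = 1 := by
        rw [← h]; congr 1; ring
      rwa [map_mul _ Polynomial.X, Polynomial.aeval_X] at h₃
    exact ⟨⟨f, _, h₂, h₁⟩, rfl⟩

/-- A nilpotent `f` has no left inverse, since `h * f = 1` would give `h ^ n * f ^ n = 1`. So `g *
f` is not a unit, hence nilpotent. -/
theorem isUnit_one_sub_mul_of_isNilpotent [Nontrivial R]
    (hR : ∀ f : R, IsNilpotent f ∨ IsUnit f) {f : R} (hf : IsNilpotent f) (g : R) :
    IsUnit (1 - g * f) := by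
  rcases hR (g * f) with h | ⟨u, hu⟩
  · exact h.isUnit_one_sub
  · exfalso
    have h₁ : (↑u⁻¹ * g) * f = 1 := by rw [mul_assoc, ← hu, Units.inv_mul]
    have h₂ : ∀ n, (↑u⁻¹ * g) ^ n * f ^ n = 1 := by
      intro n
      induction n with
      | zero => simp
      | succ n ih =>
        rw [pow_succ, pow_succ', mul_assoc, ← mul_assoc (↑u⁻¹ * g) f, h₁, one_mul, ih]
    obtain ⟨n, hn⟩ := hf
    have := h₂ n
    rw [hn, mul_zero] at this
    exact zero_ne_one this

end Fitting

/-! ### Hereditary t-structures -/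

section Hereditary

universe t' v' u'

open Pretriangulated Triangulated

/-- A nontrivial idempotent would split off a summand, so every endomorphism is nilpotent or
invertible. Over an algebraically closed field `f` has a spectral value `c`; then `f - c` is
nilpotent, and therefore radical. -/
theorem hasSplitLocalEnd_of_idempotents_split {k : Type t'} [Field k] [IsAlgClosed k]
    {C : Type u'} [Category.{v'} C] [Preadditive C] [Linear k C] [HasBinaryBiproducts C] {X : C}
    (hX : Indecomposable X) [hfin : Module.Finite k (X ⟶ X)]
    (hsplit : ∀ e : X ⟶ X, e ≫ e = e → ∃ (Y : C) (i : Y ⟶ X) (p : X ⟶ Y), i ≫ p = 𝟙 Y ∧ p ≫ i = e) :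
    HasSplitLocalEnd k X := by
  have hidem : ∀ e : End X, e * e = e → e = 0 ∨ e = 1 := by
    intro (e : X ⟶ X) (he : e ≫ e = e)
    obtain ⟨Y, i, p, hip, hpi⟩ := hsplit e he
    obtain ⟨Z, j, q, hjq, hqj⟩ := hsplit (𝟙 X - e) (by simp [he])
    have h₁ : i ≫ q = 0 := by
      have : (i ≫ p) ≫ i ≫ q ≫ (j ≫ q) = 0 := by
        rw [show (i ≫ p) ≫ i ≫ q ≫ (j ≫ q) = i ≫ (p ≫ i) ≫ (q ≫ j) ≫ q by simp, hpi, hqj]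
        simp [reassoc_of% he]
      simpa [hip, hjq] using this
    have h₂ : j ≫ p = 0 := by
      have : (j ≫ q) ≫ j ≫ p ≫ (i ≫ p) = 0 := by
        rw [show (j ≫ q) ≫ j ≫ p ≫ (i ≫ p) = j ≫ (q ≫ j) ≫ (p ≫ i) ≫ p by simp, hpi, hqj]
        simp [reassoc_of% he]
      simpa [hip, hjq] using this
    let iso : X ≅ Y ⊞ Z :=
      { hom := biprod.lift p q
        inv := biprod.desc i j
        hom_inv_id := by rw [biprod.lift_desc, hpi, hqj]; simp
        inv_hom_id := by ext <;> simp [hip, hjq, h₁, h₂] }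
    rcases hX.2 Y Z iso with h | h
    · left
      change e = 0
      rw [← hpi, h.eq_of_tgt p 0, zero_comp]
    · right
      change e = 𝟙 X
      have : 𝟙 X - e = 0 := by rw [← hqj, h.eq_of_tgt q 0, zero_comp]
      exact (sub_eq_zero.1 this).symm
  have hfin' : Module.Finite k (End X) := hfin
  have hnt : Nontrivial (End X) := ⟨⟨1, 0, fun h => hX.1 ((IsZero.iff_id_eq_zero X).2 h)⟩⟩
  have halt := isNilpotent_or_isUnit_of_forall_idempotent (k := k) hidem
  refine ⟨hX.1, fun f => ?_⟩
  let f' : End X := f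
  obtain ⟨c, hc⟩ := spectrum.nonempty_of_isAlgClosed_of_finiteDimensional k f'
  refine ⟨c, fun g => ?_⟩
  have hnil : IsNilpotent (f' - algebraMap k (End X) c) := by
    refine (halt _).resolve_right fun h => hc (spectrum.mem_resolventSet_iff.2 ?_)
    rw [← neg_sub]
    exact h.neg
  have := isUnit_one_sub_mul_of_isNilpotent halt hnil (g : End X)
  rw [Algebra.algebraMap_eq_smul_one] at this
  exact (isUnit_iff_isIso _).1 this

variable {k : Type t'} [Field k] {C : Type u'} [Category.{v'} C] [Preadditive C] [Linear k C]
  [HasZeroObject C] [HasShift C ℤ] [∀ n : ℤ, (shiftFunctor C n).Additive] [Pretriangulated C]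

theorem finite_hom_of_distTriang_left {T : Triangle C} (hT : T ∈ distTriang C) (Y : C)
    [Module.Finite k (T.obj₁ ⟶ Y)] [Module.Finite k (T.obj₃ ⟶ Y)] :
    Module.Finite k (T.obj₂ ⟶ Y) := by
  have hker : LinearMap.ker (Linear.leftComp k Y T.mor₁) ≤
      LinearMap.range (Linear.leftComp k Y T.mor₂) := by
    intro f hf
    obtain ⟨g, hg⟩ := Triangle.yoneda_exact₂ _ hT f hf
    exact ⟨g, hg.symm⟩
  have h₁ : (LinearMap.ker (Linear.leftComp k Y T.mor₁)).FG := by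
    have := Submodule.finiteDimensional_of_le hker
    exact Module.Finite.iff_fg.1 this
  exact ⟨Submodule.fg_of_fg_map_of_fg_inf_ker (Linear.leftComp k Y T.mor₁)
    (IsNoetherian.noetherian _) (by rwa [top_inf_eq])⟩

theorem finite_hom_of_distTriang_right {T : Triangle C} (hT : T ∈ distTriang C) (X : C)
    [Module.Finite k (X ⟶ T.obj₁)] [Module.Finite k (X ⟶ T.obj₃)] :
    Module.Finite k (X ⟶ T.obj₂) := by
  have hker : LinearMap.ker (Linear.rightComp k X T.mor₂) ≤
      LinearMap.range (Linear.rightComp k X T.mor₁) := by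
    intro f hf
    obtain ⟨g, hg⟩ := Triangle.coyoneda_exact₂ _ hT f hf
    exact ⟨g, hg.symm⟩
  have h₁ : (LinearMap.ker (Linear.rightComp k X T.mor₂)).FG := by
    have := Submodule.finiteDimensional_of_le hker
    exact Module.Finite.iff_fg.1 this
  exact ⟨Submodule.fg_of_fg_map_of_fg_inf_ker (Linear.rightComp k X T.mor₂)
    (IsNoetherian.noetherian _) (by rwa [top_inf_eq])⟩

variable [IsTriangulated C] (t : TStructure C)

/-- Dévissage along truncation triangles. -/
theorem CategoryTheory.Triangulated.TStructure.induction_on_pure {P : C → Prop} (n : ℕ) :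
    ∀ (a : ℤ) (_ : ∀ (X : C) (b : ℤ), a ≤ b → t.IsGE X b → t.IsLE X b → P X)
      (_ : ∀ T ∈ distTriang C, P T.obj₁ → P T.obj₃ → P T.obj₂)
      (X : C), t.IsGE X a → t.IsLE X (a + n) → P X := by
  induction n with
  | zero =>
    intro a pure ext X h₁ h₂
    exact pure X a le_rfl h₁ (by simpa using h₂)
  | succ n ih =>
    intro a pure ext X h₁ h₂
    refine ext _ (t.triangleLEGT_distinguished a X) ?_ ?_
    · exact pure _ a le_rfl (inferInstanceAs (t.IsGE ((t.truncLE a).obj X) a))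
        (inferInstanceAs (t.IsLE ((t.truncLE a).obj X) a))
    · refine ih (a + 1) (fun X b hb => pure X b (by lia)) ext _
        (inferInstanceAs (t.IsGE ((t.truncGT a).obj X) (a + 1))) ?_
      rw [show a + 1 + (n : ℤ) = a + ((n + 1 : ℕ) : ℤ) by push_cast; ring]
      exact inferInstanceAs (t.IsLE ((t.truncGT a).obj X) _)

/-- A form of heredity for a bounded t-structure, together with finiteness and split idempotents,
formulated on the objects concentrated in one degree. -/
structure CategoryTheory.Triangulated.TStructure.IsFiniteHereditary (k : Type t') [Field k]
    [Linear k C] (t : TStructure C) : Prop where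
  exists_isGE (X : C) : ∃ a, t.IsGE X a
  exists_isLE (X : C) : ∃ a, t.IsLE X a
  finite_hom (X Y : C) (a b : ℤ) : t.IsGE X a → t.IsLE X a → t.IsGE Y b → t.IsLE Y b →
    Module.Finite k (X ⟶ Y)
  -- For objects M and N placed in degrees `a` and `b`, Hom is Ext^{a-b}(M, N), so this is the
  -- vanishing of Ext from degree two on.
  hom_eq_zero (X Y : C) (a b : ℤ) : t.IsGE X a → t.IsLE X a → t.IsGE Y b → t.IsLE Y b →
    b + 2 ≤ a → ∀ f : X ⟶ Y, f = 0
  split (X : C) (a : ℤ) : t.IsGE X a → t.IsLE X a → ∀ e : X ⟶ X, e ≫ e = e →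
    ∃ (Y : C) (i : Y ⟶ X) (p : X ⟶ Y), i ≫ p = 𝟙 Y ∧ p ≫ i = e

namespace CategoryTheory.Triangulated.TStructure.IsFiniteHereditary

variable {t}

theorem exists_bounds (h : t.IsFiniteHereditary k) (X : C) : ∃ (a : ℤ) (n : ℕ), t.IsGE X a ∧ t.IsLE X (a + n) := by
  obtain ⟨a, ha⟩ := h.exists_isGE X
  obtain ⟨b, hb⟩ := h.exists_isLE X
  exact ⟨a, (b - a).toNat, ha, t.isLE_of_le X b _ (by lia)⟩

theorem finite_hom_all (h : t.IsFiniteHereditary k) (X Y : C) : Module.Finite k (X ⟶ Y) := by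
  obtain ⟨a, n, ha, hn⟩ := h.exists_bounds X
  obtain ⟨b, m, hb, hm⟩ := h.exists_bounds Y
  refine t.induction_on_pure (P := fun X => Module.Finite k (X ⟶ Y)) n a ?_
    (fun T hT h₁ h₃ => finite_hom_of_distTriang_left hT Y) X ha hn
  intro X c _ hc hc'
  refine t.induction_on_pure (P := fun Y => Module.Finite k (X ⟶ Y)) m b ?_
    (fun T hT h₁ h₃ => finite_hom_of_distTriang_right hT X) Y hb hm
  intro Y d _ hd hd'
  exact h.finite_hom X Y c d hc hc' hd hd'

theorem hom_eq_zero_of_isGE (h : t.IsFiniteHereditary k) (X Y : C) (a b : ℤ) (hX : t.IsGE X a) (hY : t.IsGE Y b)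
    (hY' : t.IsLE Y b) (hab : b + 2 ≤ a) (f : X ⟶ Y) : f = 0 := by
  obtain ⟨c, hc⟩ := h.exists_isLE X
  have hc' : t.IsLE X (a + (c - a).toNat) := t.isLE_of_le X c _ (by lia)
  refine t.induction_on_pure (P := fun X => ∀ f : X ⟶ Y, f = 0) (c - a).toNat a
    (fun X d hd h₁ h₂ => h.hom_eq_zero X Y d b h₁ h₂ hY hY' (by lia)) ?_ X hX hc' f
  intro T hT h₁ h₃ f
  obtain ⟨g, hg⟩ := Triangle.yoneda_exact₂ _ hT f (h₁ _)
  rw [hg, h₃ g, comp_zero]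

/-- The truncation triangle at the lowest degree `a` has its connecting morphism going from degrees
at least `a + 1` to degree `a - 1`, so it vanishes by heredity and the triangle splits.
Indecomposability kills one of the two truncations. -/
theorem exists_degree (h : t.IsFiniteHereditary k) {X : C} (hX : Indecomposable X) : ∃ a, t.IsGE X a ∧ t.IsLE X a := by
  obtain ⟨a, n, ha, hn⟩ := h.exists_bounds X
  induction n generalizing a with
  | zero => exact ⟨a, ha, by simpa using hn⟩
  | succ n ih =>
    have hT := t.triangleLEGT_distinguished a X
    have hle : t.IsLE ((t.truncLE a).obj X) a := inferInstance
    have hge : t.IsGE ((t.truncLE a).obj X) a := inferInstance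
    have hzero : ((t.triangleLEGT a).obj X).mor₃ = 0 :=
      h.hom_eq_zero_of_isGE ((t.truncGT a).obj X) (((t.truncLE a).obj X)⟦(1 : ℤ)⟧) (a + 1) (a - 1)
        inferInstance (t.isGE_shift _ a 1 (a - 1) (by lia)) (t.isLE_shift _ a 1 (a - 1) (by lia))
        (by lia) _
    obtain ⟨e, -⟩ := exists_iso_binaryBiproduct_of_distTriang _ hT hzero
    rcases hX.2 _ _ e with hz | hz
    · refine ih (a + 1) ((t.isGE_iff_isZero_truncLE_obj a (a + 1) rfl X).2 hz) ?_
      rwa [show a + 1 + (n : ℤ) = a + ((n + 1 : ℕ) : ℤ) by push_cast; ring]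
    · exact ⟨a, ha, (t.isLE_iff_isZero_truncGT_obj a X).2 hz⟩

theorem hasSplitLocalEnd (h : t.IsFiniteHereditary k) [IsAlgClosed k] {X : C} (hX : Indecomposable X) :
    HasSplitLocalEnd k X := by
  obtain ⟨a, ha, ha'⟩ := h.exists_degree hX
  have := h.finite_hom_all X X
  exact hasSplitLocalEnd_of_idempotents_split hX (h.split X a ha ha')

theorem isTube_of_periodic (h : t.IsFiniteHereditary k) [IsAlgClosed k] [∀ n : ℤ, (shiftFunctor C n).Linear k]
    (D : SerreFunctor k C) {x₀ : ARQuiver k C} {r : ℕ} (hr : 1 ≤ r)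
    (hx₀ : (ARQuiver.tau D)^[r] x₀ = x₀) : IsTube D (Quiver.WeaklyConnectedComponent.mk x₀) := by
  choose! deg hdeg hdeg' using fun (X : C) (hX : Indecomposable X) => h.exists_degree hX
  have unique : ∀ {X : C} {a b : ℤ}, Indecomposable X → t.IsGE X a → t.IsLE X a → t.IsGE X b →
      t.IsLE X b → a ≤ b := by
    intro X a b hX ha _ _ hb
    by_contra hab
    exact hX.1 (t.isZero X b a (by lia))
  -- The sign is needed because `X⟦n⟧` sits in cohomological degree `deg X - n`.
  refine _root_.isTube_of_periodic D h.finite_hom_all (fun X hX => h.hasSplitLocalEnd hX)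
    (fun X => - deg X) ?_ ?_ hr hx₀
  · intro X Y hX hY f hf
    have := hdeg X hX
    have := hdeg' X hX
    have := hdeg Y hY
    have := hdeg' Y hY
    constructor
    · by_contra hlt
      exact hf (t.zero f (deg X) (deg Y) (by lia))
    · by_contra hlt
      exact hf (h.hom_eq_zero X Y (deg X) (deg Y) ‹_› ‹_› ‹_› ‹_› (by lia) f)
  · intro X n hX
    have hXn : Indecomposable (X⟦n⟧) := indecomposable_obj_of_isEquivalence (shiftFunctor C n) hX
    have := hdeg X hX
    have := hdeg' X hX
    have h₁ := t.isGE_shift X (deg X) n (deg X - n) (by lia)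
    have h₂ := t.isLE_shift X (deg X) n (deg X - n) (by lia)
    have h₃ := unique hXn (hdeg _ hXn) (hdeg' _ hXn) h₁ h₂
    have h₄ := unique hXn h₁ h₂ (hdeg _ hXn) (hdeg' _ hXn)
    lia

end CategoryTheory.Triangulated.TStructure.IsFiniteHereditary

end Hereditary

/-! ### Bounded derived categories of hereditary abelian categories -/

section HereditaryAbelian

universe t' w' v' u'

open DerivedCategory

variable {A : Type u'} [Category.{v'} A] [Abelian A]

/-- Morphisms from an object of the heart to an object concentrated in negative degrees
are effaceable. -/
theorem DerivedCategory.exists_epi_map_comp_eq_zero [HasDerivedCategory.{w'} A] (M : A)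
    {Y : DerivedCategory A} [Y.IsLE (-1)] (α : (singleFunctor A 0).obj M ⟶ Y) :
    ∃ (P : A) (π : P ⟶ M), Epi π ∧ (singleFunctor A 0).map π ≫ α = 0 := by
  obtain ⟨K, hK, ⟨e⟩⟩ := exists_iso_Q_obj_of_isLE Y (-1)
  let S := (CochainComplex.singleFunctor A 0).obj M
  obtain ⟨X', hX', s, hs, g, hg⟩ :=
    right_fac_of_isStrictlyLE (X := S) (Y := K) (α ≫ e.hom) 0
  -- The morphism is a roof over a quasi-isomorphism `s` whose source `X'` vanishes in positive
  -- degrees, so the term of `X'` in degree 0 includes as a subcomplex. It serves as `P`; its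
  -- composite into `K` vanishes because `K` is zero in degree 0.
  let j : (CochainComplex.singleFunctor A 0).obj (X'.X 0) ⟶ X' :=
    HomologicalComplex.mkHomFromSingle (𝟙 _) fun i hi => by
      have hi' : (0 : ℤ) + 1 = i := hi
      exact (X'.isZero_of_isStrictlyLE 0 i (by lia)).eq_of_tgt _ _
  obtain ⟨π, hπ⟩ := (CochainComplex.singleFunctor A 0).map_surjective (j ≫ s)
  have hjg : j ≫ g = 0 := HomologicalComplex.from_single_hom_ext
    ((K.isZero_of_isStrictlyLE (-1) 0 (by lia)).eq_of_tgt _ _)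
  have hjf : IsIso (j.f 0) := by
    dsimp only [j]
    rw [HomologicalComplex.mkHomFromSingle_f]
    exact IsIso.comp_isIso' (Iso.isIso_hom _) (inferInstanceAs (IsIso (𝟙 _)))
  refine ⟨X'.X 0, π, ⟨fun {N} a b hab => ?_⟩, ?_⟩
  · have h₁ : s ≫ (CochainComplex.singleFunctor A 0).map a =
        s ≫ (CochainComplex.singleFunctor A 0).map b := by
      refine HomologicalComplex.to_single_hom_ext ?_
      rw [← cancel_epi (j.f 0)]
      have := congrArg (CochainComplex.singleFunctor A 0).map hab
      rw [Functor.map_comp, Functor.map_comp, hπ, Category.assoc, Category.assoc] at this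
      exact HomologicalComplex.congr_hom this 0
    have h₂ := congrArg Q.map h₁
    rw [Q.map_comp, Q.map_comp, cancel_epi] at h₂
    exact (singleFunctor A 0).map_injective h₂
  · rw [← cancel_mono e.hom, Category.assoc, zero_comp]
    refine (congrArg ((singleFunctor A 0).map π ≫ ·) hg).trans ?_
    change Q.map ((CochainComplex.singleFunctor A 0).map π) ≫ _ = 0
    rw [hπ, Q.map_comp, Category.assoc, IsIso.hom_inv_id_assoc, ← Q.map_comp, hjg, Q.map_zero]

theorem CategoryTheory.Abelian.Ext.subsingleton_of_two_le [HasExt.{w'} A]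
    (h : ∀ X Y : A, Subsingleton (Abelian.Ext X Y 2)) {n : ℕ} (hn : 2 ≤ n) :
    ∀ X Y : A, Subsingleton (Abelian.Ext X Y n) := by
  induction n, hn using Nat.le_induction with
  | base => exact h
  | succ n hn ih =>
    intro X Y
    refine subsingleton_of_forall_eq 0 fun x => ?_
    let := HasDerivedCategory.standard A
    have : (((singleFunctor A 0).obj Y)⟦((n + 1 : ℕ) : ℤ)⟧).IsLE (-1) := by
      have := TStructure.t.isLE_shift ((singleFunctor A 0).obj Y) 0 ((n + 1 : ℕ) : ℤ)
        (-((n + 1 : ℕ) : ℤ)) (by lia)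
      exact TStructure.t.isLE_of_le _ (-((n + 1 : ℕ) : ℤ)) _ (by lia)
    obtain ⟨P, π, hπ, hx⟩ := exists_epi_map_comp_eq_zero X
      (Y := ((singleFunctor A 0).obj Y)⟦((n + 1 : ℕ) : ℤ)⟧) x.hom
    let S := ShortComplex.mk (kernel.ι π) π (kernel.condition π)
    have hS : S.ShortExact :=
      { exact := ShortComplex.exact_of_f_is_kernel _ (kernelIsKernel π) }
    obtain ⟨x₁, hx₁⟩ := Abelian.Ext.contravariant_sequence_exact₃ hS Y x (by
      ext
      rw [Abelian.Ext.comp_hom, Abelian.Ext.mk₀_hom, ShiftedHom.mk₀_comp]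
      simpa using hx) (show 1 + n = n + 1 by lia)
    have := ih S.X₁ Y
    rw [← hx₁, Subsingleton.elim x₁ 0, Abelian.Ext.comp_zero]

variable [HasDerivedCategory.{w'} A] {k : Type t'} [Field k] [Linear k A]

namespace DerivedCategory

/-- Morphisms between objects concentrated in one degree embed into an extension group. -/
theorem exists_injective_hom_to_ext [HasExt.{max u' v'} A] {X Y : DerivedCategory A} {a b : ℤ}
    (_ : X.IsGE a) (_ : X.IsLE a) (_ : Y.IsGE b) (_ : Y.IsLE b) {n : ℕ} (hn : b + n = a) :
    ∃ (M N : A) (F : (X ⟶ Y) →ₗ[k] Abelian.Ext M N n), Function.Injective F := by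
  obtain ⟨M, ⟨eX⟩⟩ := exists_iso_singleFunctor_obj_of_isGE_of_isLE X a
  obtain ⟨N, ⟨eY⟩⟩ := exists_iso_singleFunctor_obj_of_isGE_of_isLE Y b
  let e₁ : X⟦a⟧ ≅ (singleFunctor A 0).obj M :=
    (shiftFunctor _ a).mapIso eX ≪≫ ((singleFunctors A).shiftIso a 0 a (by lia)).app M
  let e₂ : Y⟦a⟧ ≅ ((singleFunctor A 0).obj N)⟦(n : ℤ)⟧ :=
    (shiftFunctor _ a).mapIso eY ≪≫ ((singleFunctors A).shiftIso a (-n) b (by lia)).app N ≪≫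
      (((singleFunctors A).shiftIso n (-n) 0 (by lia)).app N).symm
  let F₁ : (X ⟶ Y) →ₗ[k] (X⟦a⟧ ⟶ Y⟦a⟧) := (shiftFunctor _ a).mapLinearMap k
  refine ⟨M, N, (Abelian.Ext.homLinearEquiv.symm.toLinearMap ∘ₗ
    (Linear.homCongr k e₁ e₂).toLinearMap) ∘ₗ F₁, ?_⟩
  rw [LinearMap.coe_comp, LinearMap.coe_comp]
  exact (Abelian.Ext.homLinearEquiv.symm.injective.comp
    (Linear.homCongr k e₁ e₂).injective).comp (shiftFunctor _ a).map_injective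

theorem exists_splitting {X : DerivedCategory A} {a : ℤ}
    (_ : X.IsGE a) (_ : X.IsLE a) (e : X ⟶ X) (he : e ≫ e = e) :
    ∃ (M : A) (i : (singleFunctor A a).obj M ⟶ X) (p : X ⟶ (singleFunctor A a).obj M),
      i ≫ p = 𝟙 _ ∧ p ≫ i = e := by
  obtain ⟨N, ⟨eX⟩⟩ := exists_iso_singleFunctor_obj_of_isGE_of_isLE X a
  obtain ⟨f, hf⟩ := (singleFunctor A a).map_surjective (eX.inv ≫ e ≫ eX.hom)
  obtain ⟨M, i, p, hip, hpi⟩ := IsIdempotentComplete.idempotents_split N f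
    ((singleFunctor A a).map_injective (by simp [hf, reassoc_of% he]))
  refine ⟨M, (singleFunctor A a).map i ≫ eX.inv, eX.hom ≫ (singleFunctor A a).map p, ?_, ?_⟩
  · simp [← Functor.map_comp, hip]
  · rw [Category.assoc, ← Functor.map_comp_assoc, hpi, hf]
    simp

namespace Bounded

instance (n : ℤ) : (shiftFunctor (Bounded A) n).Linear k where
  map_smul {X Y} f r := by
    apply (Bounded.ι (C := A)).map_injective
    rw [← cancel_mono (((Bounded.ι (C := A)).commShiftIso n).hom.app Y)]
    have h₁ := ((Bounded.ι (C := A)).commShiftIso n).hom.naturality (r • f)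
    have h₂ := ((Bounded.ι (C := A)).commShiftIso n).hom.naturality f
    dsimp only [Functor.comp_map] at h₁ h₂
    rw [h₁, Functor.map_smul (Bounded.ι (C := A)), Functor.map_smul, Functor.map_smul,
      Linear.smul_comp, h₂, Linear.comp_smul]

theorem isFiniteHereditary (hfin : IsExtFinite A k) (hher : IsHereditary A) :
    (TStructure.t (C := A)).onBounded.IsFiniteHereditary k := by
  let := HasExt.standard A
  have hfin' : ∀ (X Y : A) (i : ℕ), Module.Finite k (Abelian.Ext X Y i) := hfin
  have hher' : ∀ (X Y : A), Subsingleton (Abelian.Ext X Y 2) := hher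
  let E (X Y : Bounded A) : (X ⟶ Y) ≃ₗ[k] (X.obj ⟶ Y.obj) :=
    LinearEquiv.ofBijective ((Bounded.ι (C := A)).mapLinearMap k)
      ⟨(Bounded.ι (C := A)).map_injective, (Bounded.ι (C := A)).map_surjective⟩
  have hGE : ∀ {X : Bounded A} {n : ℤ}, (TStructure.t (C := A)).onBounded.IsGE X n → X.obj.IsGE n :=
    fun h => (ObjectProperty.tStructure_isGE_iff _ _ _ _).1 h
  have hLE : ∀ {X : Bounded A} {n : ℤ}, (TStructure.t (C := A)).onBounded.IsLE X n → X.obj.IsLE n :=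
    fun h => (ObjectProperty.tStructure_isLE_iff _ _ _ _).1 h
  refine ⟨fun X => ?_, fun X => ?_, ?_, ?_, ?_⟩
  · obtain ⟨a, ha⟩ := X.property.1
    exact ⟨a, (ObjectProperty.tStructure_isGE_iff _ _ _ _).2 ha⟩
  · obtain ⟨a, ha⟩ := X.property.2
    exact ⟨a, (ObjectProperty.tStructure_isLE_iff _ _ _ _).2 ha⟩
  · intro X Y a b hX hX' hY hY'
    by_cases hab : b ≤ a
    · obtain ⟨M, N, F, hF⟩ := exists_injective_hom_to_ext (k := k) (hGE hX) (hLE hX') (hGE hY)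
        (hLE hY') (n := (a - b).toNat) (by lia)
      have := hfin' M N (a - b).toNat
      exact Module.Finite.of_injective (F ∘ₗ (E X Y).toLinearMap) (hF.comp (E X Y).injective)
    · have : Subsingleton (X ⟶ Y) := subsingleton_of_forall_eq 0 fun f =>
        (TStructure.t (C := A)).onBounded.zero f a b (by lia)
      exact Module.Finite.of_finite
  · intro X Y a b hX hX' hY hY' hab f
    obtain ⟨M, N, F, hF⟩ := exists_injective_hom_to_ext (k := k) (hGE hX) (hLE hX') (hGE hY)
      (hLE hY') (n := (a - b).toNat) (by lia)
    have := Abelian.Ext.subsingleton_of_two_le hher' (n := (a - b).toNat) (by lia) M N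
    exact (hF.comp (E X Y).injective) (Subsingleton.elim _ _)
  · intro X a hX hX' e he
    obtain ⟨M, i, p, hip, hpi⟩ := exists_splitting (hGE hX) (hLE hX') e.hom
      (congrArg (Bounded.ι (C := A)).map he)
    exact ⟨⟨(singleFunctor A a).obj M, ⟨a, inferInstance⟩, ⟨a, inferInstance⟩⟩,
      ObjectProperty.homMk i, ObjectProperty.homMk p, (Bounded.ι (C := A)).map_injective hip,
      (Bounded.ι (C := A)).map_injective hpi⟩

end Bounded

end DerivedCategory

end HereditaryAbelian

namespace ARQuiver

universe t' v' u'

variable {k : Type t'} [Field k] {C : Type u'} [Category.{v'} C] [Preadditive C] [Linear k C]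
  [HasBinaryBiproducts C] [HasShift C ℤ]

theorem indecomposable_iterate_tau (D : SerreFunctor k C) {X : C} (hX : Indecomposable X) (n : ℕ) :
    Indecomposable (D.tau.obj^[n] X) := by
  induction n with
  | zero => exact hX
  | succ n ih =>
    rw [Function.iterate_succ_apply']
    exact indecomposable_obj_of_isEquivalence D.tau ih

variable [HasZeroObject C] [∀ n : ℤ, (shiftFunctor C n).Additive] [Pretriangulated C]

theorem iterate_tau_mk (D : SerreFunctor k C) {X : C} (hX : Indecomposable X) (n : ℕ) :
    (tau D)^[n] (mk k X hX) = mk k (D.tau.obj^[n] X) (indecomposable_iterate_tau D hX n) := by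
  induction n with
  | zero => rfl
  | succ n ih =>
    simp only [Function.iterate_succ_apply', ih]
    exact tau_mk D _ _

theorem iterate_tau_mk_eq_self_iff (D : SerreFunctor k C) {X : C} (hX : Indecomposable X) (n : ℕ) :
    (tau D)^[n] (mk k X hX) = mk k X hX ↔ Nonempty (D.tau.obj^[n] X ≅ X) := by
  rw [iterate_tau_mk, mk_eq_mk_iff]

end ARQuiver

theorem TubeQuiver.iterate_tau {r : ℕ} (n : ℕ) (x : TubeQuiver r) :
    TubeQuiver.tau^[n] x = (x.1 - n, x.2) := by
  induction n with
  | zero => exact Prod.ext (by simp) rfl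
  | succ n ih =>
    rw [Function.iterate_succ_apply', ih]
    exact Prod.ext (by simp [TubeQuiver.tau, sub_sub]) rfl

theorem theorem4p1 {k : Type t} [Field k] [IsAlgClosed k]
    {A : Type u} [Category.{v} A] [Abelian A] [Linear k A] [HasDerivedCategory.{w} A]
    (hfin : IsExtFinite A k) (hher : IsHereditary A)
    (D : SerreFunctor k (DerivedCategory.Bounded A))
    (K : Quiver.WeaklyConnectedComponent (ARQuiver k (DerivedCategory.Bounded A))) :
    IsTube D K ↔
      ∃ (X : DerivedCategory.Bounded A) (hX : Indecomposable X),
        Quiver.WeaklyConnectedComponent.mk (ARQuiver.mk k X hX) = K ∧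
        ∃ r : ℕ, 1 ≤ r ∧ Nonempty (D.tau.obj^[r] X ≅ X) := by
  constructor
  · rintro ⟨r, hr, e, -, he⟩
    let x : TubeQuiver r := (0, 0)
    have hx : ∀ n, (e (TubeQuiver.tau^[n] x)).1 = (ARQuiver.tau D)^[n] (e x).1 := fun n => by
      induction n with
      | zero => rfl
      | succ n ih => rw [Function.iterate_succ_apply', he, ih, Function.iterate_succ_apply']
    have hr' := hx r
    rw [TubeQuiver.iterate_tau, CharP.cast_eq_zero, sub_zero] at hr'
    obtain ⟨⟨X, hX⟩, hX'⟩ := Quotient.exists_rep (e x).1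
    change ARQuiver.mk k X hX = (e x).1 at hX'
    refine ⟨X, hX, by rw [hX']; exact (e x).2, r, hr, ?_⟩
    rw [← ARQuiver.iterate_tau_mk_eq_self_iff D hX, hX']
    exact hr'.symm
  · rintro ⟨X, hX, rfl, r, hr, hX'⟩
    exact (DerivedCategory.Bounded.isFiniteHereditary hfin hher).isTube_of_periodic D hr
      ((ARQuiver.iterate_tau_mk_eq_self_iff D hX r).2 hX')
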